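/- Let $\Omega\subset\mathbb R^N$ be open with $N\ge 5$, and let $g:\Omega\to[0,\infty]$ be Lebesgue measurable. Denote by $\mathcal D^{2,2}_0(\Omega)$ the completion of $C_c^\infty(\Omega)$ (real valued functions) with respect to the norm $\|\Delta u\|_{L^2(\Omega)}$; since $N\ge5$, it is a space of locally integrable functions on $\Omega$: $u$ belongs to it if and only if there are $\varphi_n\in C_c^\infty(\Omega)$ with $\varphi_n\to u$ in $L^1_{loc}(\Omega)$ and $\Delta\varphi_n$ convergent in $L^2(\Omega)$, and the limit of $\Delta\varphi_n$ is then the weak Laplacian $\Delta u$. Call $g$ admissible if $g\in L^1_{loc}(\Omega)$ and there is a constant $C>0$ such that $$\int_\Omega g\,u^2\,dx\le C\int_\Omega|\Delta u|^2\,dx\qquad\text{for all }u\in\mathcal D^{2,2}_0(\Omega).$$ Let $g^*(t)=\inf\{s>0:\ |\{x\in\Omega: g(x)>s\}|<t\}$, $t>0$, be the decreasing rearrangement of $g$, and let $g\in L^{\frac N4,\infty}(\Omega)$ mean that $g$ is finite almost everywhere and $\sup_{t>0}t^{4/N}g^*(t)<\infty$. (i) If $g\in L^{\frac N4,\infty}(\Omega)$,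 then $g$ is admissible. (ii) Suppose in addition that $\Omega$ is an open ball centred at the origin or $\Omega=\mathbb R^N$, and that $g$ is radial and radially decreasing (that is, $g(x)$ depends only on $|x|$ and is nonincreasing in $|x|$). If $g$ is admissible, then $g\in L^{\frac N4,\infty}(\Omega)$. -/

import Mathlib

open MeasureTheory Filter Topology
open scoped ENNReal

namespace HardyRellich

/-- `φ ∈ C_c^∞(Ω)`, real valued and extended by zero to the whole space. -/
def IsTestFunction {N : ℕ} (Ω : Set (EuclideanSpace ℝ (Fin N)))
    (φ : EuclideanSpace ℝ (Fin N) → ℝ) : Prop :=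
  ContDiff ℝ ((⊤ : ℕ∞) : WithTop ℕ∞) φ ∧ HasCompactSupport φ ∧ tsupport φ ⊆ Ω

/-- `w` is the weak (distributional) Laplacian of `u` on `Ω`; both are locally integrable on `Ω`,
so for open `Ω` it is unique up to a null subset of `Ω`. -/
def IsWeakLaplacian {N : ℕ} (Ω : Set (EuclideanSpace ℝ (Fin N)))
    (u w : EuclideanSpace ℝ (Fin N) → ℝ) : Prop :=
  LocallyIntegrableOn u Ω ∧ LocallyIntegrableOn w Ω ∧
    ∀ φ : EuclideanSpace ℝ (Fin N) → ℝ, IsTestFunction Ω φ →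
      ∫ x in Ω, u x * Laplacian.laplacian φ x = ∫ x in Ω, w x * φ x

/-- `u ∈ D₀^{2,2}(Ω)`, the completion of `C_c^∞(Ω)` for the norm `‖Δφ‖_{L²(Ω)}`, realised as a
space of functions: `u` is the limit in `L¹_loc(Ω)` of test functions `φ n` whose Laplacians
converge in `L²(Ω)`, and this limit is the weak Laplacian of `u`.
(For `N ≥ 5` the Sobolev inequality `‖φ‖_{L^{2N/(N-4)}} ≤ c ‖Δφ‖_{L²}` shows that every sequence of
test functions that is Cauchy for the norm has such a limit, and two Cauchy sequences have the same
limit exactly when they are equivalent, so this is the completion.) -/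
def MemD22 {N : ℕ} (Ω : Set (EuclideanSpace ℝ (Fin N)))
    (u : EuclideanSpace ℝ (Fin N) → ℝ) : Prop :=
  ∃ w : EuclideanSpace ℝ (Fin N) → ℝ,
    IsWeakLaplacian Ω u w ∧ MemLp w 2 (volume.restrict Ω) ∧
    ∃ φ : ℕ → EuclideanSpace ℝ (Fin N) → ℝ,
      (∀ n, IsTestFunction Ω (φ n)) ∧
      (∀ K : Set (EuclideanSpace ℝ (Fin N)), IsCompact K → K ⊆ Ω →
        Tendsto (fun n => ∫⁻ x in K, ‖u x - φ n x‖ₑ) atTop (𝓝 0)) ∧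
      Tendsto (fun n => eLpNorm (fun x => w x - Laplacian.laplacian (φ n) x) 2
        (volume.restrict Ω)) atTop (𝓝 0)

/-- A nonnegative weight `g` is admissible on `Ω`: `g ∈ L¹_loc(Ω)` and there is `C > 0` with
`∫_Ω g u² ≤ C ∫_Ω |Δu|²` for all `u ∈ D₀^{2,2}(Ω)`. Here `Δu` is the weak Laplacian `w` of `u`,
which exists and is unique up to null sets. -/
def Admissible {N : ℕ} (Ω : Set (EuclideanSpace ℝ (Fin N)))
    (g : EuclideanSpace ℝ (Fin N) → ℝ≥0∞) : Prop :=
  (∀ K : Set (EuclideanSpace ℝ (Fin N)), IsCompact K → K ⊆ Ω → ∫⁻ x in K, g x < ∞) ∧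
  ∃ C : ℝ, 0 < C ∧ ∀ u w : EuclideanSpace ℝ (Fin N) → ℝ, MemD22 Ω u → IsWeakLaplacian Ω u w →
    ∫⁻ x in Ω, g x * ENNReal.ofReal (u x ^ 2) ≤
      ENNReal.ofReal C * ∫⁻ x in Ω, ENNReal.ofReal (w x ^ 2)

/-- The distribution function `α_g(s) = |{x ∈ Ω : g x > s}|` of a nonnegative function. -/
noncomputable def distribution {N : ℕ} (Ω : Set (EuclideanSpace ℝ (Fin N)))
    (g : EuclideanSpace ℝ (Fin N) → ℝ≥0∞) (s : ℝ≥0∞) : ℝ≥0∞ :=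
  volume {x ∈ Ω | s < g x}

/-- The decreasing rearrangement `g^*(t) = inf {s > 0 : α_g(s) < t}` for `t > 0`
(the infimum is `∞` if no finite `s` qualifies). -/
noncomputable def rearrangement {N : ℕ} (Ω : Set (EuclideanSpace ℝ (Fin N)))
    (g : EuclideanSpace ℝ (Fin N) → ℝ≥0∞) (t : ℝ) : ℝ≥0∞ :=
  sInf {s : ℝ≥0∞ | 0 < s ∧ distribution Ω g s < ENNReal.ofReal t}

/-- The Lorentz quasinorm `|g|_{(p,∞)} = sup_{t > 0} t^{1/p} g^*(t)`. -/
noncomputable def lorentzQuasinorm {N : ℕ} (Ω : Set (EuclideanSpace ℝ (Fin N))) (p : ℝ)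
    (g : EuclideanSpace ℝ (Fin N) → ℝ≥0∞) : ℝ≥0∞ :=
  ⨆ (t : ℝ) (_ : 0 < t), ENNReal.ofReal (t ^ (1 / p)) * rearrangement Ω g t

/-- Membership of a nonnegative function in the weak Lebesgue (Lorentz) space `L^{p,∞}(Ω)`:
Lebesgue measurable, finite almost everywhere, with finite quasinorm. -/
def MemWeakLp {N : ℕ} (Ω : Set (EuclideanSpace ℝ (Fin N))) (p : ℝ)
    (g : EuclideanSpace ℝ (Fin N) → ℝ≥0∞) : Prop :=
  AEMeasurable g (volume.restrict Ω) ∧ (∀ᵐ x ∂volume.restrict Ω, g x < ∞) ∧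
    lorentzQuasinorm Ω p g < ∞

/-- `g` is radial on `Ω`. -/
def IsRadialOn {N : ℕ} (Ω : Set (EuclideanSpace ℝ (Fin N)))
    (g : EuclideanSpace ℝ (Fin N) → ℝ≥0∞) : Prop :=
  ∀ x ∈ Ω, ∀ y ∈ Ω, ‖x‖ = ‖y‖ → g x = g y

/-- `g` is radially decreasing (nonincreasing in `|x|`) on `Ω`. -/
def IsRadiallyDecreasingOn {N : ℕ} (Ω : Set (EuclideanSpace ℝ (Fin N)))
    (g : EuclideanSpace ℝ (Fin N) → ℝ≥0∞) : Prop :=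
  ∀ x ∈ Ω, ∀ y ∈ Ω, ‖x‖ < ‖y‖ → g y ≤ g x

end HardyRellich

namespace HardyRellich

/-! (i) A test function is dominated pointwise by a multiple of the Newtonian potential `V` of
`|Δφ|` (`exists_abs_le_newtonPotential_laplacian`), so it suffices that `f ↦ √g V f` is bounded on
`L²`. For `1 < p < N/2` this map has weak type `(p, p)` when `g ∈ L^{N/4,∞}`
(`weak_type_newtonPotential`). To see this, cut the kernel at radius `R`: the far part is bounded by
Hölder's inequality, the near part by Young's and Chebyshev's, and `R` is adapted to the level.
Since `N ≥ 5`, the range of `p` contains exponents on both sides of `2`, and Marcinkiewicz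
interpolation gives the strong bound (`exists_lintegral_mul_newtonPotential_sq_le`). Fatou's lemma
along an a.e. convergent subsequence carries the inequality to the completion
(`admissible_of_forall_isTestFunction`).

(ii) Test admissibility with a bump rescaled to radius comparable with `‖x‖`. Its energy scales like
`‖x‖^(N-4)`, while the left side is at least `g x` times the volume of a ball of radius `‖x‖/2`, by
monotonicity. Hence `g x ≤ B / ‖x‖^4` (`Admissible.exists_le_norm_rpow`), and the superlevel sets
lie in balls whose volumes give the weak bound. -/

/-! ### Dilations and integrals of powers of the norm. -/

/-- Change of variables `z ↦ R • z` in a lower integral. -/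
lemma lintegral_comp_smul_pos {N : ℕ} {R : ℝ} (hR : 0 < R)
    {F : EuclideanSpace ℝ (Fin N) → ℝ≥0∞} (hF : Measurable F) :
    ENNReal.ofReal (R ^ N) * ∫⁻ z, F (R • z) = ∫⁻ z, F z := by
  have h := Measure.map_addHaar_smul (volume : Measure (EuclideanSpace ℝ (Fin N))) hR.ne'
  have h2 : ∫⁻ z, F (R • z) = ∫⁻ z, F z ∂(Measure.map (R • ·) volume) :=
    (lintegral_map hF (measurable_const_smul R)).symm
  rw [h2, h, lintegral_smul_measure, smul_eq_mul, ← mul_assoc, ← ENNReal.ofReal_mul (by positivity),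
    finrank_euclideanSpace_fin, abs_of_pos (by positivity), mul_inv_cancel₀ (by positivity)]
  simp

/-- Homogeneity: it reduces power integrals over balls of radius `R`, and over their complements, to
the case `R = 1`, where only finiteness is needed. -/
lemma setLIntegral_norm_rpow_scale {N : ℕ} {R : ℝ} (hR : 0 < R) (a : ℝ)
    {S : Set (EuclideanSpace ℝ (Fin N))} (hS : MeasurableSet S) :
    ∫⁻ z in {z | R⁻¹ • z ∈ S}, ENNReal.ofReal (‖z‖ ^ a) =
      ENNReal.ofReal (R ^ (N + a)) * ∫⁻ z in S, ENNReal.ofReal (‖z‖ ^ a) := by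
  have hS' : MeasurableSet {z : EuclideanSpace ℝ (Fin N) | R⁻¹ • z ∈ S} :=
    (measurable_const_smul R⁻¹) hS
  rw [← lintegral_indicator hS', ← lintegral_indicator hS,
    ← lintegral_comp_smul_pos hR (Measurable.indicator (by fun_prop) hS'),
    Real.rpow_add hR, Real.rpow_natCast, ENNReal.ofReal_mul (by positivity), mul_assoc]
  congr 1
  rw [← lintegral_const_mul' _ _ ENNReal.ofReal_ne_top]
  refine lintegral_congr fun z => ?_
  by_cases hz : z ∈ S
  · rw [Set.indicator_of_mem (by simpa [smul_smul, hR.ne'] using hz), Set.indicator_of_mem hz,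
      ← ENNReal.ofReal_mul (by positivity), norm_smul, Real.norm_of_nonneg hR.le,
      Real.mul_rpow hR.le (norm_nonneg z)]
  · rw [Set.indicator_of_notMem (by simpa [smul_smul, hR.ne'] using hz),
      Set.indicator_of_notMem hz, mul_zero]

lemma exists_setLIntegral_ball_norm_rpow {N : ℕ} (hN : 1 ≤ N) {a : ℝ} (ha : -(N : ℝ) < a) :
    ∃ c : ℝ, 0 < c ∧ ∀ R : ℝ, 0 < R →
      ∫⁻ z in Metric.ball (0 : EuclideanSpace ℝ (Fin N)) R, ENNReal.ofReal (‖z‖ ^ a) ≤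
        ENNReal.ofReal (c * R ^ (N + a)) := by
  have hfin : ∫⁻ z in Metric.ball (0 : EuclideanSpace ℝ (Fin N)) 1, ENNReal.ofReal (‖z‖ ^ a)
      < ∞ := by
    have : IntegrableOn (fun z : EuclideanSpace ℝ (Fin N) => ‖z‖ ^ a) (Metric.ball 0 1) := by
      refine integrableOn_ball_of_norm_le_rpow (C := 1) (α := -a) (by simpa) (by simp; linarith)
        (ae_of_all _ fun z => ?_) (measurable_norm.pow_const a).aestronglyMeasurable
      rw [neg_neg, one_mul, Real.norm_of_nonneg (by positivity)]
    exact this.lintegral_lt_top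
  -- The summand `1` only serves to make the constant positive.
  refine ⟨(∫⁻ z in Metric.ball (0 : EuclideanSpace ℝ (Fin N)) 1,
    ENNReal.ofReal (‖z‖ ^ a)).toReal + 1,
    add_pos_of_nonneg_of_pos ENNReal.toReal_nonneg one_pos, fun R hR => ?_⟩
  · have h := setLIntegral_norm_rpow_scale (N := N) hR a
      (Metric.isOpen_ball (x := 0) (ε := 1)).measurableSet
    have hset : {z : EuclideanSpace ℝ (Fin N) | R⁻¹ • z ∈ Metric.ball 0 1} = Metric.ball 0 R := by
      ext z
      simp [norm_smul, abs_of_pos hR, inv_mul_lt_iff₀ hR]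
    rw [hset] at h
    rw [h, mul_comm, ENNReal.ofReal_mul (by positivity)]
    gcongr
    rw [ENNReal.ofReal_add (by positivity) (by positivity), ENNReal.ofReal_toReal hfin.ne]
    exact le_self_add

lemma exists_setLIntegral_compl_ball_norm_rpow {N : ℕ} {a : ℝ} (ha : a < -(N : ℝ)) :
    ∃ c : ℝ, 0 < c ∧ ∀ R : ℝ, 0 < R →
      ∫⁻ z in (Metric.ball (0 : EuclideanSpace ℝ (Fin N)) R)ᶜ, ENNReal.ofReal (‖z‖ ^ a) ≤
        ENNReal.ofReal (c * R ^ (N + a)) := by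
  have hfin : ∫⁻ z in (Metric.ball (0 : EuclideanSpace ℝ (Fin N)) 1)ᶜ, ENNReal.ofReal (‖z‖ ^ a)
      < ∞ := by
    have h1 := finite_integral_one_add_norm (μ := (volume : Measure (EuclideanSpace ℝ (Fin N))))
      (r := -a) (by simp; linarith)
    -- Outside the unit ball `1 + ‖z‖ ≤ 2‖z‖`, and `a` is negative, so an integrable power of `1 +
    -- ‖z‖` dominates.
    calc _ ≤ ∫⁻ z in (Metric.ball (0 : EuclideanSpace ℝ (Fin N)) 1)ᶜ,
            ENNReal.ofReal (2 ^ (-a)) * ENNReal.ofReal ((1 + ‖z‖) ^ (- -a)) := by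
          refine setLIntegral_mono (by fun_prop) fun z hz => ?_
          have hz : 1 ≤ ‖z‖ := by simpa using hz
          rw [← ENNReal.ofReal_mul (by positivity)]
          gcongr
          rw [neg_neg, Real.rpow_neg (by norm_num), ← div_eq_inv_mul,
            ← Real.div_rpow (by positivity) (by norm_num)]
          exact Real.rpow_le_rpow_of_nonpos (by positivity) (by linarith)
            (by have : (0:ℝ) ≤ N := by positivity
                linarith)
      _ ≤ ENNReal.ofReal (2 ^ (-a)) * ∫⁻ z : EuclideanSpace ℝ (Fin N),
            ENNReal.ofReal ((1 + ‖z‖) ^ (- -a)) := by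
          rw [lintegral_const_mul' _ _ ENNReal.ofReal_ne_top]
          gcongr
          exact Measure.restrict_le_self
      _ < ∞ := ENNReal.mul_lt_top ENNReal.ofReal_lt_top h1
  refine ⟨(∫⁻ z in (Metric.ball (0 : EuclideanSpace ℝ (Fin N)) 1)ᶜ,
    ENNReal.ofReal (‖z‖ ^ a)).toReal + 1,
    add_pos_of_nonneg_of_pos ENNReal.toReal_nonneg one_pos, fun R hR => ?_⟩
  · have h := setLIntegral_norm_rpow_scale (N := N) hR a
      (Metric.isOpen_ball (x := 0) (ε := 1)).measurableSet.compl
    have hset : {z : EuclideanSpace ℝ (Fin N) | R⁻¹ • z ∈ (Metric.ball 0 1)ᶜ} =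
        (Metric.ball 0 R)ᶜ := by
      ext z
      simp [norm_smul, abs_of_pos hR, le_inv_mul_iff₀ hR]
    rw [hset] at h
    rw [h, mul_comm, ENNReal.ofReal_mul (by positivity)]
    gcongr
    rw [ENNReal.ofReal_add (by positivity) (by positivity), ENNReal.ofReal_toReal hfin.ne]
    exact le_self_add

/-! ### Newtonian potentials: near and far parts. -/

/-- Young's inequality `‖k ⋆ f‖_p ≤ ‖k‖₁ ‖f‖_p` for nonnegative functions. -/
lemma lintegral_conv_rpow_le {N : ℕ} {k f : EuclideanSpace ℝ (Fin N) → ℝ≥0∞}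
    (hk : Measurable k) (hf : Measurable f) {p : ℝ} (hp : 1 < p) :
    ∫⁻ x, (∫⁻ y, k (x - y) * f y) ^ p ≤ (∫⁻ z, k z) ^ p * ∫⁻ y, f y ^ p := by
  set I := ∫⁻ z, k z with hI
  set q := p.conjExponent
  have hpq : p.HolderConjugate q := .conjExponent hp
  have hp0 : 0 < p := by linarith
  have key : ∀ x, (∫⁻ y, k (x - y) * f y) ^ p ≤ I ^ (p - 1) * ∫⁻ y, k (x - y) * f y ^ p := by
    intro x
    -- Splitting the kernel as `k^(1/p) k^(1/q)` makes Hölder's inequality act as Jensen's for the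
    -- measure `k (x - y) dy` of mass `I`; Tonelli's theorem then finishes.
    have h := ENNReal.lintegral_mul_le_Lp_mul_Lq volume hpq
      (f := fun y => k (x - y) ^ (1 / p) * f y) (g := fun y => k (x - y) ^ (1 / q))
      (by fun_prop) (by fun_prop)
    have e1 : ∀ y, ((fun y => k (x - y) ^ (1 / p) * f y) * fun y => k (x - y) ^ (1 / q)) y =
        k (x - y) * f y := by
      intro y
      have : k (x - y) = k (x - y) ^ (1 / p) * k (x - y) ^ (1 / q) := by
        rw [← ENNReal.rpow_add_of_nonneg _ _ (one_div_nonneg.2 hp0.le)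
          (one_div_nonneg.2 hpq.symm.pos.le)]
        have := hpq.inv_add_inv_eq_one
        simp only [one_div, this, ENNReal.rpow_one]
      simp only [Pi.mul_apply]
      conv_rhs => rw [this]
      ring
    have e2 : ∀ y, (k (x - y) ^ (1 / p) * f y) ^ p = k (x - y) * f y ^ p := by
      intro y
      rw [ENNReal.mul_rpow_of_nonneg _ _ hp0.le, ← ENNReal.rpow_mul, one_div_mul_cancel hp0.ne',
        ENNReal.rpow_one]
    have e3 : ∀ y, (k (x - y) ^ (1 / q)) ^ q = k (x - y) := by
      intro y
      rw [← ENNReal.rpow_mul, one_div_mul_cancel hpq.symm.pos.ne', ENNReal.rpow_one]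
    simp_rw [e1, e2, e3] at h
    rw [lintegral_sub_left_eq_self (fun z => k z) x, ← hI] at h
    calc _ ≤ _ := ENNReal.rpow_le_rpow h hp0.le
      _ = _ := by
        rw [ENNReal.mul_rpow_of_nonneg _ _ hp0.le, ← ENNReal.rpow_mul, ← ENNReal.rpow_mul,
          one_div_mul_cancel hp0.ne', ENNReal.rpow_one, mul_comm]
        congr 2
        have := hpq.sub_one_mul_conj
        field_simp [hpq.symm.pos.ne']
        linarith
  calc _ ≤ ∫⁻ x, I ^ (p - 1) * ∫⁻ y, k (x - y) * f y ^ p := lintegral_mono key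
    _ = I ^ (p - 1) * ∫⁻ x, ∫⁻ y, k (x - y) * f y ^ p := by
      apply lintegral_const_mul
      exact Measurable.lintegral_prod_right' (f := fun z : _ × _ => k (z.1 - z.2) * f z.2 ^ p)
        (by fun_prop)
    _ = I ^ (p - 1) * ∫⁻ y, I * f y ^ p := by
      rw [lintegral_lintegral_swap (by fun_prop)]
      congr 1
      refine lintegral_congr fun y => ?_
      rw [lintegral_mul_const _ (by fun_prop), lintegral_sub_right_eq_self (fun z => k z) y]
    _ = _ := by
      rw [lintegral_const_mul _ (by fun_prop), ← mul_assoc]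
      congr 1
      nth_rw 2 [← ENNReal.rpow_one I]
      rw [← ENNReal.rpow_add_of_nonneg _ _ (by linarith) (by norm_num)]
      simp

/-- The Newtonian kernel `‖z‖ ^ (2 - N)`, up to its normalising constant. -/
noncomputable def newtonKernel {N : ℕ} (z : EuclideanSpace ℝ (Fin N)) : ℝ≥0∞ :=
  ENNReal.ofReal (‖z‖ ^ (2 - N : ℝ))

/-- The Newtonian potential of a nonnegative function, up to the normalising constant. -/
noncomputable def newtonPotential {N : ℕ} (f : EuclideanSpace ℝ (Fin N) → ℝ≥0∞)
    (x : EuclideanSpace ℝ (Fin N)) : ℝ≥0∞ :=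
  ∫⁻ y, newtonKernel (x - y) * f y

@[fun_prop]
lemma measurable_newtonKernel {N : ℕ} :
    Measurable (newtonKernel : EuclideanSpace ℝ (Fin N) → ℝ≥0∞) := by
  unfold newtonKernel
  fun_prop

lemma measurable_lintegral_conv {N : ℕ} {k f : EuclideanSpace ℝ (Fin N) → ℝ≥0∞}
    (hk : Measurable k) (hf : Measurable f) : Measurable fun x => ∫⁻ y, k (x - y) * f y :=
  Measurable.lintegral_prod_right' (f := fun z : _ × _ => k (z.1 - z.2) * f z.2) (by fun_prop)

lemma measurable_newtonPotential {N : ℕ} {f : EuclideanSpace ℝ (Fin N) → ℝ≥0∞}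
    (hf : Measurable f) : Measurable (newtonPotential f) :=
  measurable_lintegral_conv measurable_newtonKernel hf

lemma newtonPotential_add {N : ℕ} {f₁ f₂ : EuclideanSpace ℝ (Fin N) → ℝ≥0∞}
    (hf : Measurable f₁) (x : EuclideanSpace ℝ (Fin N)) :
    newtonPotential (f₁ + f₂) x = newtonPotential f₁ x + newtonPotential f₂ x := by
  unfold newtonPotential
  rw [← lintegral_add_left (by fun_prop)]
  simp [mul_add]

/-- Contribution to the Newtonian potential from outside the ball of radius `R`. -/
lemma exists_far_potential_le {N : ℕ} {p : ℝ} (hp : 1 < p) (hpN : p < N / 2) :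
    ∃ c : ℝ, 0 < c ∧ ∀ f : EuclideanSpace ℝ (Fin N) → ℝ≥0∞, Measurable f → ∀ R : ℝ, 0 < R → ∀ x,
      ∫⁻ y, (Metric.ball 0 R)ᶜ.indicator newtonKernel (x - y) * f y ≤
        ENNReal.ofReal (c * R ^ (2 - N / p : ℝ)) * (∫⁻ y, f y ^ p) ^ (1 / p) := by
  set q := p.conjExponent with hq
  have hpq : p.HolderConjugate q := .conjExponent hp
  have hq0 := hpq.symm.pos
  have hp0 := hpq.pos
  have hN : (2 : ℝ) < N := by linarith
  have hq' : q = p / (p - 1) := rfl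
  -- The kernel is `q`-integrable at infinity exactly because `p < N / 2`.
  have ha : (2 - N : ℝ) * q < -(N : ℝ) := by
    have : 0 < p - 1 := by linarith
    rw [hq', ← sub_pos]
    have : -(N : ℝ) - (2 - N) * (p / (p - 1)) = (N - 2 * p) / (p - 1) := by field_simp; ring
    rw [this]
    apply div_pos <;> linarith
  obtain ⟨c, hc, hcR⟩ := exists_setLIntegral_compl_ball_norm_rpow (N := N) ha
  refine ⟨c ^ (1 / q), by positivity, fun f hf R hR x => ?_⟩
  have hm : MeasurableSet ((Metric.ball (0 : EuclideanSpace ℝ (Fin N)) R)ᶜ) :=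
    Metric.isOpen_ball.measurableSet.compl
  have hkm : Measurable ((Metric.ball (0 : EuclideanSpace ℝ (Fin N)) R)ᶜ.indicator
      newtonKernel) := measurable_newtonKernel.indicator hm
  have h := ENNReal.lintegral_mul_le_Lp_mul_Lq volume hpq.symm
    (f := fun y => (Metric.ball 0 R)ᶜ.indicator newtonKernel (x - y)) (g := f)
    (by fun_prop) (by fun_prop)
  refine h.trans ?_
  gcongr
  rw [lintegral_sub_left_eq_self (fun z => (Metric.ball (0 : EuclideanSpace ℝ (Fin N)) R)ᶜ.indicator
      newtonKernel z ^ q) x]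
  have e : ∀ z, (Metric.ball (0 : EuclideanSpace ℝ (Fin N)) R)ᶜ.indicator newtonKernel z ^ q =
      (Metric.ball (0 : EuclideanSpace ℝ (Fin N)) R)ᶜ.indicator
        (fun z => ENNReal.ofReal (‖z‖ ^ ((2 - N : ℝ) * q))) z := by
    intro z
    by_cases hz : z ∈ (Metric.ball (0 : EuclideanSpace ℝ (Fin N)) R)ᶜ
    · rw [Set.indicator_of_mem hz, Set.indicator_of_mem hz, newtonKernel,
        ENNReal.ofReal_rpow_of_nonneg (by positivity) hq0.le, ← Real.rpow_mul (norm_nonneg z)]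
    · rw [Set.indicator_of_notMem hz, Set.indicator_of_notMem hz, ENNReal.zero_rpow_of_pos hq0]
  simp_rw [e]
  rw [lintegral_indicator hm]
  calc _ ≤ ENNReal.ofReal (c * R ^ (N + (2 - N : ℝ) * q)) ^ (1 / q) :=
        ENNReal.rpow_le_rpow (hcR R hR) (by positivity)
    _ = _ := by
      rw [ENNReal.ofReal_rpow_of_nonneg (by positivity) (by positivity),
        Real.mul_rpow hc.le (by positivity), ← Real.rpow_mul hR.le]
      congr 3
      have := hpq.inv_add_inv_eq_one
      have h1 : (N : ℝ) / p = N * (1 - q⁻¹) := by rw [← this]; ring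
      rw [h1]
      field_simp
      ring

/-- The part of the Newtonian potential from inside the ball of radius `R` has `L^p` operator norm
of order `R ^ 2`. -/
lemma exists_near_potential_le {N : ℕ} (hN : 1 ≤ N) {p : ℝ} (hp : 1 < p) :
    ∃ c : ℝ, 0 < c ∧ ∀ f : EuclideanSpace ℝ (Fin N) → ℝ≥0∞, Measurable f → ∀ R : ℝ, 0 < R →
      ∫⁻ x, (∫⁻ y, (Metric.ball 0 R).indicator newtonKernel (x - y) * f y) ^ p ≤
        ENNReal.ofReal ((c * R ^ 2) ^ p) * ∫⁻ y, f y ^ p := by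
  obtain ⟨c, hc, hcR⟩ := exists_setLIntegral_ball_norm_rpow hN (a := 2 - N) (by linarith)
  refine ⟨c, hc, fun f hf R hR => ?_⟩
  have hm : MeasurableSet ((Metric.ball (0 : EuclideanSpace ℝ (Fin N)) R)) :=
    Metric.isOpen_ball.measurableSet
  refine (lintegral_conv_rpow_le (measurable_newtonKernel.indicator hm) hf hp).trans ?_
  gcongr
  rw [lintegral_indicator hm, ← ENNReal.ofReal_rpow_of_nonneg (by positivity) (by linarith)]
  refine ENNReal.rpow_le_rpow ?_ (by linarith)
  simpa [newtonKernel] using hcR R hR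

/-! ### Weak type bounds and real interpolation. -/

/-- Weak type `(p, p)` of `f ↦ √g V f`, where `V` is the Newtonian potential and `g ∈ L^{N/4,∞}`. -/
lemma weak_type_newtonPotential {N : ℕ} {p : ℝ} (hp : 1 < p) (hpN : p < N / 2)
    {g : EuclideanSpace ℝ (Fin N) → ℝ≥0∞} {A : ℝ} (hA : 0 ≤ A)
    (hgA : ∀ s : ℝ, 0 < s →
      volume {x | ENNReal.ofReal s < g x} ≤ ENNReal.ofReal (A * s ^ (-(N / 4) : ℝ))) :
    ∃ C : ℝ, 0 < C ∧ ∀ f : EuclideanSpace ℝ (Fin N) → ℝ≥0∞, Measurable f → ∀ t : ℝ, 0 < t →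
      volume {x | ENNReal.ofReal (t ^ 2) < g x * newtonPotential f x ^ 2} ≤
        ENNReal.ofReal (C * t ^ (-p)) * ∫⁻ y, f y ^ p := by
  have hN1 : (2 : ℝ) < N := by linarith
  have hN : 1 ≤ N := by
    have : (1 : ℝ) ≤ N := by linarith
    exact_mod_cast this
  have hp0 : 0 < p := by linarith
  obtain ⟨c, hc, hfar⟩ := exists_far_potential_le hp hpN
  obtain ⟨b, hb, hnear⟩ := exists_near_potential_le hN hp
  refine ⟨A * (2 * c) ^ (N / 2 : ℝ) + (b / c) ^ p, by positivity, fun f hf t ht => ?_⟩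
  set C := A * (2 * c) ^ (N / 2 : ℝ) + (b / c) ^ p with hC
  have hC0 : 0 < C := by positivity
  set F := ∫⁻ y, f y ^ p with hF
  rcases eq_or_ne F ∞ with hFt | hFt
  · rw [hFt, ENNReal.mul_top]
    · exact le_top
    · simp only [ne_eq, ENNReal.ofReal_eq_zero, not_le]
      positivity
  rcases eq_or_ne F 0 with hF0 | hF0
  · have h0 : f =ᵐ[volume] 0 := by
      have := (lintegral_eq_zero_iff (by fun_prop)).1 (hF.symm.trans hF0)
      filter_upwards [this] with x hx
      simpa [hp0, hp0.not_gt] using hx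
    have hV : ∀ x, newtonPotential f x = 0 := by
      intro x
      unfold newtonPotential
      rw [lintegral_eq_zero_iff (by fun_prop)]
      filter_upwards [h0] with y hy
      simp [hy]
    simp [hV]
  have hFr : 0 < F.toReal := ENNReal.toReal_pos hF0 hFt
  -- This radius satisfies `R^N = t^(-p) F`, the order of the required bound. It also turns the far
  -- estimate `c R^(2 - N/p) F^(1/p)` into `c t R²`.
  set R := (F.toReal / t ^ p) ^ (1 / N : ℝ) with hR
  have hN0 : (0 : ℝ) < N := by linarith
  have hR0 : 0 < R := by positivity
  have hRN : R ^ (N : ℝ) = F.toReal / t ^ p := by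
    rw [hR, ← Real.rpow_mul (by positivity), one_div_mul_cancel hN0.ne', Real.rpow_one]
  have hFR : F = ENNReal.ofReal (R ^ (N : ℝ) * t ^ p) := by
    rw [hRN, div_mul_cancel₀ _ (by positivity), ENNReal.ofReal_toReal hFt]
  have hm : MeasurableSet ((Metric.ball (0 : EuclideanSpace ℝ (Fin N)) R)) :=
    Metric.isOpen_ball.measurableSet
  set U : EuclideanSpace ℝ (Fin N) → ℝ≥0∞ := fun x =>
    ∫⁻ y, (Metric.ball 0 R).indicator newtonKernel (x - y) * f y with hU
  have hUm : Measurable U := measurable_lintegral_conv (measurable_newtonKernel.indicator hm) hf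
  -- Chosen so that `s (2 c t R²)² = t²`: if `g ≤ s` and the near part is below `c t R²`, then `g (V
  -- f)²` cannot exceed `t²`. Both exceptional sets have measure of order `R^N`.
  set s := (2 * c * R ^ 2)⁻¹ ^ 2 with hs
  have hs0 : 0 < s := by positivity
  have hVle : ∀ x, newtonPotential f x ≤ U x + ENNReal.ofReal (c * t * R ^ 2) := by
    intro x
    have hsplit : newtonPotential f x = U x +
        ∫⁻ y, (Metric.ball 0 R)ᶜ.indicator newtonKernel (x - y) * f y := by
      have hkm := (measurable_newtonKernel (N := N)).indicator hm
      rw [hU]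
      dsimp only
      rw [← lintegral_add_left (by fun_prop)]
      refine lintegral_congr fun y => ?_
      rw [← add_mul, Set.indicator_self_add_compl_apply]
    rw [hsplit]
    gcongr
    refine (hfar f hf R hR0 x).trans (le_of_eq ?_)
    rw [← hF, hFR, ENNReal.ofReal_rpow_of_nonneg (by positivity) (by positivity),
      ← ENNReal.ofReal_mul (by positivity), Real.mul_rpow (by positivity) (by positivity),
      ← Real.rpow_mul hR0.le, ← Real.rpow_mul ht.le, mul_one_div_cancel hp0.ne', Real.rpow_one,
      Real.rpow_sub hR0, mul_one_div]
    congr 1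
    have : R ^ (2 : ℝ) = R ^ 2 := by norm_cast
    rw [this]
    field_simp
  have hsub : {x | ENNReal.ofReal (t ^ 2) < g x * newtonPotential f x ^ 2} ⊆
      {x | ENNReal.ofReal s < g x} ∪ {x | ENNReal.ofReal ((c * t * R ^ 2) ^ p) ≤ U x ^ p} := by
    intro x hx
    by_contra hcon
    simp only [Set.mem_union, Set.mem_ofPred_eq, not_or, not_lt, not_le] at hcon hx
    obtain ⟨h1, h2⟩ := hcon
    rw [← ENNReal.ofReal_rpow_of_nonneg (by positivity) hp0.le,
      ENNReal.rpow_lt_rpow_iff hp0] at h2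
    refine hx.not_ge ?_
    calc g x * newtonPotential f x ^ 2 ≤
        ENNReal.ofReal s * (ENNReal.ofReal (c * t * R ^ 2) + ENNReal.ofReal (c * t * R ^ 2)) ^ 2 := by
          gcongr
          exact (hVle x).trans (by gcongr)
      _ = ENNReal.ofReal (t ^ 2) := by
        rw [← ENNReal.ofReal_add (by positivity) (by positivity), ← ENNReal.ofReal_pow (by positivity),
          ← ENNReal.ofReal_mul (by positivity), hs]
        congr 1
        field_simp
        ring
  have hFt' : ENNReal.ofReal (C * t ^ (-p)) * F = ENNReal.ofReal (C * R ^ (N : ℝ)) := by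
    rw [hFR, ← ENNReal.ofReal_mul (by positivity), Real.rpow_neg ht.le]
    congr 1
    have : t ^ p ≠ 0 := by positivity
    field_simp
  rw [hFt', hC, add_mul, ENNReal.ofReal_add (by positivity) (by positivity)]
  refine (measure_mono hsub).trans ((measure_union_le _ _).trans (add_le_add ?_ ?_))
  · refine (hgA s hs0).trans (le_of_eq ?_)
    congr 1
    rw [mul_assoc]
    congr 1
    rw [hs, ← Real.rpow_natCast _ 2, ← Real.rpow_mul (by positivity), Real.inv_rpow (by positivity),
      ← Real.rpow_neg (by positivity), Real.mul_rpow (by positivity) (by positivity),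
      ← Real.rpow_natCast R 2, ← Real.rpow_mul hR0.le]
    congr 2 <;> (push_cast; ring)
  · have hpos : ENNReal.ofReal ((c * t * R ^ 2) ^ p) ≠ 0 := by
      simp only [ne_eq, ENNReal.ofReal_eq_zero, not_le]
      positivity
    refine (meas_ge_le_lintegral_div (by fun_prop) hpos ENNReal.ofReal_ne_top).trans ?_
    rw [ENNReal.div_le_iff hpos ENNReal.ofReal_ne_top]
    refine (hnear f hf R hR0).trans (le_of_eq ?_)
    rw [← hF, hFR, ← ENNReal.ofReal_mul (by positivity), ← ENNReal.ofReal_mul (by positivity)]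
    congr 1
    rw [mul_comm (R ^ (N : ℝ)), ← mul_assoc, mul_right_comm _ (R ^ (N : ℝ)),
      ← Real.mul_rpow (by positivity) (by positivity),
      ← Real.mul_rpow (by positivity) (by positivity)]
    congr 2
    field_simp

/-- One half of the layer-cake formula, with levels `t²` because the quantity integrated later is
quadratic in `f`; the interpolation needs only this inequality. -/
lemma le_lintegral_two_mul (b : ℝ≥0∞) :
    b ≤ ∫⁻ t in Set.Ioi (0 : ℝ), if ENNReal.ofReal (t ^ 2) < b then ENNReal.ofReal (2 * t) else 0 := by
  have hfin : ∀ r : ℝ, 0 < r → ENNReal.ofReal (r ^ 2) ≤ b →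
      ENNReal.ofReal (r ^ 2) ≤ ∫⁻ t in Set.Ioi (0 : ℝ),
        if ENNReal.ofReal (t ^ 2) < b then ENNReal.ofReal (2 * t) else 0 := by
    intro r hr hrb
    have hint : ∫ t in Set.Ioo (0 : ℝ) r, 2 * t = r ^ 2 := by
      rw [← integral_Ioc_eq_integral_Ioo, ← intervalIntegral.integral_of_le hr.le,
        intervalIntegral.integral_const_mul, integral_id]
      ring
    calc ENNReal.ofReal (r ^ 2) = ∫⁻ t in Set.Ioo (0 : ℝ) r, ENNReal.ofReal (2 * t) := by
          rw [← hint, ofReal_integral_eq_lintegral_ofReal]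
          · exact (Continuous.integrableOn_Icc (by fun_prop)).mono_set Set.Ioo_subset_Icc_self
          · refine (ae_restrict_iff' measurableSet_Ioo).2 (ae_of_all _ fun t ht => ?_)
            have := ht.1
            simp only [Pi.zero_apply]
            positivity
      _ ≤ ∫⁻ t in Set.Ioo (0 : ℝ) r,
            if ENNReal.ofReal (t ^ 2) < b then ENNReal.ofReal (2 * t) else 0 := by
          refine setLIntegral_mono' measurableSet_Ioo fun t ht => ?_
          rw [if_pos]
          refine lt_of_lt_of_le ?_ hrb
          have := ht.1
          have := ht.2
          rw [ENNReal.ofReal_lt_ofReal_iff (by positivity)]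
          gcongr
      _ ≤ _ := lintegral_mono_set Set.Ioo_subset_Ioi_self
  refine ENNReal.le_of_forall_nnreal_lt fun r hr => ?_
  rcases eq_or_ne r 0 with rfl | hr0
  · simp
  have hr0 : 0 < (r : ℝ) := by positivity
  have h := hfin (√r) (by positivity) (by simpa using hr.le)
  simpa using h

/-- Interpolation integral for the high part of `f`: for finite `a` only `t < a` contributes, and `2
t^(-1/2)` is integrable at `0`, as `3/2 < 2`. -/
lemma lintegral_two_mul_rpow_le_small (a : ℝ≥0∞) :
    ∫⁻ t in Set.Ioi (0 : ℝ), ENNReal.ofReal (2 * t * t ^ (-(3 / 2) : ℝ)) *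
      (if ENNReal.ofReal t < a then a else 0) ^ (3 / 2 : ℝ) ≤ 4 * a ^ 2 := by
  rcases eq_or_ne a ∞ with rfl | ha
  · simp [ENNReal.top_pow, ENNReal.mul_top]
  rcases eq_or_ne a 0 with rfl | ha0
  · simp
  obtain ⟨r, hr, rfl⟩ : ∃ r : ℝ, 0 < r ∧ a = ENNReal.ofReal r :=
    ⟨a.toReal, ENNReal.toReal_pos ha0 ha, (ENNReal.ofReal_toReal ha).symm⟩
  have hint : ∫ t in Set.Ioo (0 : ℝ) r, 2 * t ^ (-(1 / 2) : ℝ) = 4 * r ^ (1 / 2 : ℝ) := by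
    rw [← integral_Ioc_eq_integral_Ioo, ← intervalIntegral.integral_of_le hr.le,
      intervalIntegral.integral_const_mul, integral_rpow (by left; norm_num)]
    rw [Real.zero_rpow (by norm_num)]
    norm_num
    ring
  calc _ ≤ ∫⁻ t in Set.Ioi (0 : ℝ), (Set.Ioo 0 r).indicator (fun t =>
        ENNReal.ofReal (2 * t ^ (-(1 / 2) : ℝ))) t * ENNReal.ofReal (r ^ (3 / 2 : ℝ)) := by
        refine setLIntegral_mono' measurableSet_Ioi fun t (ht : 0 < t) => ?_
        by_cases htr : t < r
        · rw [if_pos ((ENNReal.ofReal_lt_ofReal_iff hr).2 htr), Set.indicator_of_mem (show t ∈ Set.Ioo 0 r from ⟨ht, htr⟩),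
            ENNReal.ofReal_rpow_of_nonneg hr.le (by norm_num)]
          have e : 2 * t * t ^ (-(3 / 2) : ℝ) = 2 * t ^ (-(1 / 2) : ℝ) := by
            nth_rw 1 [← Real.rpow_one t]
            rw [mul_assoc, ← Real.rpow_add ht]
            norm_num
          rw [e]
        · rw [if_neg (fun h => htr ((ENNReal.ofReal_lt_ofReal_iff hr).1 h)),
            ENNReal.zero_rpow_of_pos (by norm_num)]
          simp
    _ = ENNReal.ofReal (4 * r ^ (1 / 2 : ℝ)) * ENNReal.ofReal (r ^ (3 / 2 : ℝ)) := by
        rw [lintegral_mul_const' _ _ ENNReal.ofReal_ne_top]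
        congr 1
        rw [lintegral_indicator measurableSet_Ioo, Measure.restrict_restrict measurableSet_Ioo,
          Set.inter_eq_left.2 Set.Ioo_subset_Ioi_self, ← hint, ofReal_integral_eq_lintegral_ofReal]
        · apply Integrable.const_mul
          exact (intervalIntegral.integrableOn_Ioo_rpow_iff hr).2 (by norm_num)
        · refine (ae_restrict_iff' measurableSet_Ioo).2 (ae_of_all _ fun t ht => ?_)
          have := ht.1
          simp only [Pi.zero_apply]
          positivity
    _ = _ := by
        have h4 : (4 : ℝ≥0∞) = ENNReal.ofReal 4 := by simp
        rw [h4, ← ENNReal.ofReal_mul (by positivity), ← ENNReal.ofReal_pow hr.le,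
          ← ENNReal.ofReal_mul (by positivity), mul_assoc, ← Real.rpow_add hr]
        norm_num

/-- The counterpart for the low part of `f`: for finite `a` only `t ≥ a` contributes, and `2
t^(-5/4)` is integrable at infinity, as `9/4 > 2`. -/
lemma lintegral_two_mul_rpow_le_large (a : ℝ≥0∞) :
    ∫⁻ t in Set.Ioi (0 : ℝ), ENNReal.ofReal (2 * t * t ^ (-(9 / 4) : ℝ)) *
      (if ENNReal.ofReal t < a then 0 else a) ^ (9 / 4 : ℝ) ≤ 8 * a ^ 2 := by
  rcases eq_or_ne a ∞ with rfl | ha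
  · simp
  rcases eq_or_ne a 0 with rfl | ha0
  · simp
  obtain ⟨r, hr, rfl⟩ : ∃ r : ℝ, 0 < r ∧ a = ENNReal.ofReal r :=
    ⟨a.toReal, ENNReal.toReal_pos ha0 ha, (ENNReal.ofReal_toReal ha).symm⟩
  have hint : ∫ t in Set.Ioi r, 2 * t ^ (-(5 / 4) : ℝ) = 8 * r ^ (-(1 / 4) : ℝ) := by
    rw [integral_const_mul, integral_Ioi_rpow_of_lt (by norm_num) hr]
    norm_num
    ring
  calc _ ≤ ∫⁻ t in Set.Ioi (0 : ℝ), (Set.Ici r).indicator (fun t =>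
        ENNReal.ofReal (2 * t ^ (-(5 / 4) : ℝ))) t * ENNReal.ofReal (r ^ (9 / 4 : ℝ)) := by
        refine setLIntegral_mono' measurableSet_Ioi fun t (ht : 0 < t) => ?_
        by_cases htr : t < r
        · rw [if_pos ((ENNReal.ofReal_lt_ofReal_iff hr).2 htr),
            ENNReal.zero_rpow_of_pos (by norm_num)]
          simp
        · rw [if_neg (fun h => htr ((ENNReal.ofReal_lt_ofReal_iff hr).1 h)),
            Set.indicator_of_mem (Set.mem_Ici.2 (not_lt.1 htr)),
            ENNReal.ofReal_rpow_of_nonneg hr.le (by norm_num)]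
          have e : 2 * t * t ^ (-(9 / 4) : ℝ) = 2 * t ^ (-(5 / 4) : ℝ) := by
            nth_rw 1 [← Real.rpow_one t]
            rw [mul_assoc, ← Real.rpow_add ht]
            norm_num
          rw [e]
    _ = ENNReal.ofReal (8 * r ^ (-(1 / 4) : ℝ)) * ENNReal.ofReal (r ^ (9 / 4 : ℝ)) := by
        rw [lintegral_mul_const' _ _ ENNReal.ofReal_ne_top]
        congr 1
        rw [lintegral_indicator measurableSet_Ici, Measure.restrict_restrict measurableSet_Ici,
          Set.inter_eq_left.2 (Set.Ici_subset_Ioi.2 hr),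
          ← restrict_Ioi_eq_restrict_Ici, ← hint, ofReal_integral_eq_lintegral_ofReal]
        · exact (integrableOn_Ioi_rpow_of_lt (by norm_num) hr).const_mul 2
        · refine (ae_restrict_iff' measurableSet_Ioi).2 (ae_of_all _ fun t ht => ?_)
          have : 0 < t := hr.trans ht
          simp only [Pi.zero_apply]
          positivity
    _ = _ := by
        have h4 : (8 : ℝ≥0∞) = ENNReal.ofReal 8 := by simp
        rw [h4, ← ENNReal.ofReal_mul (by positivity), ← ENNReal.ofReal_pow hr.le,
          ← ENNReal.ofReal_mul (by positivity), mul_assoc, ← Real.rpow_add hr]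
        norm_num

/-- Strong type `(2, 2)` of `f ↦ √g V f`, by real interpolation between two weak type bounds. -/
lemma exists_lintegral_mul_newtonPotential_sq_le {N : ℕ} (hN : 5 ≤ N)
    {g : EuclideanSpace ℝ (Fin N) → ℝ≥0∞} (hg : Measurable g) {A : ℝ} (hA : 0 ≤ A)
    (hgA : ∀ s : ℝ, 0 < s →
      volume {x | ENNReal.ofReal s < g x} ≤ ENNReal.ofReal (A * s ^ (-(N / 4) : ℝ))) :
    ∃ C : ℝ, 0 < C ∧ ∀ f : EuclideanSpace ℝ (Fin N) → ℝ≥0∞, Measurable f →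
      ∫⁻ x, g x * newtonPotential f x ^ 2 ≤ ENNReal.ofReal C * ∫⁻ y, f y ^ 2 := by
  have hN' : (5 : ℝ) ≤ N := by exact_mod_cast hN
  -- Any exponents with `1 < p₀ < 2 < p₁ < N/2` would do; `9/4 < 5/2 ≤ N/2` is where `N ≥ 5` enters.
  obtain ⟨C₀, hC₀, hw₀⟩ := weak_type_newtonPotential (p := 3 / 2) (by norm_num) (by linarith) hA hgA
  obtain ⟨C₁, hC₁, hw₁⟩ := weak_type_newtonPotential (p := 9 / 4) (by norm_num) (by linarith) hA hgA
  refine ⟨4 * (4 * C₀ + 8 * C₁), by positivity, fun f hf => ?_⟩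
  set T : EuclideanSpace ℝ (Fin N) → ℝ≥0∞ := fun x => g x * newtonPotential f x ^ 2 with hT
  have hTm : Measurable T := by
    have := measurable_newtonPotential hf
    fun_prop
  set f₁ : ℝ → EuclideanSpace ℝ (Fin N) → ℝ≥0∞ := fun t y =>
    if ENNReal.ofReal t < f y then f y else 0 with hf₁
  set f₂ : ℝ → EuclideanSpace ℝ (Fin N) → ℝ≥0∞ := fun t y =>
    if ENNReal.ofReal t < f y then 0 else f y with hf₂
  have hset : MeasurableSet {z : ℝ × EuclideanSpace ℝ (Fin N) | ENNReal.ofReal z.1 < f z.2} :=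
    measurableSet_lt (by fun_prop) (by fun_prop)
  have hf₁p : Measurable (Function.uncurry f₁) :=
    Measurable.ite hset (by fun_prop) measurable_const
  have hf₂p : Measurable (Function.uncurry f₂) :=
    Measurable.ite hset measurable_const (by fun_prop)
  have hf₁m : ∀ t, Measurable (f₁ t) := fun t => hf₁p.comp measurable_prodMk_left
  have hf₂m : ∀ t, Measurable (f₂ t) := fun t => hf₂p.comp measurable_prodMk_left
  -- The function is cut at the same height `t` at which the operator is measured. The division by
  -- `4` absorbs `(a + b)² ≤ 4 max (a²) (b²)`, so one of the two pieces must already exceed level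
  -- `t²`.
  have hdist : ∀ t : ℝ, 0 < t → volume {x | ENNReal.ofReal (t ^ 2) < T x / 4} ≤
      ENNReal.ofReal (C₀ * t ^ (-(3 / 2) : ℝ)) * (∫⁻ y, f₁ t y ^ (3 / 2 : ℝ)) +
      ENNReal.ofReal (C₁ * t ^ (-(9 / 4) : ℝ)) * ∫⁻ y, f₂ t y ^ (9 / 4 : ℝ) := by
    intro t ht
    refine le_trans ?_ (add_le_add (hw₀ _ (hf₁m t) t ht) (hw₁ _ (hf₂m t) t ht))
    refine le_trans (measure_mono ?_) (measure_union_le _ _)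
    intro x hx
    by_contra hcon
    simp only [Set.mem_union, Set.mem_ofPred_eq, not_or, not_lt] at hcon hx
    refine hx.not_ge ?_
    have hsum : newtonPotential f x = newtonPotential (f₁ t) x + newtonPotential (f₂ t) x := by
      rw [← newtonPotential_add (hf₁m t)]
      congr 1
      ext y
      simp only [Pi.add_apply, hf₁, hf₂]
      split_ifs <;> simp
    rw [ENNReal.div_le_iff (by norm_num) (by norm_num)]
    simp only [hT, hsum]
    set a := newtonPotential (f₁ t) x
    set b := newtonPotential (f₂ t) x
    have hab : (a + b) ^ 2 ≤ 4 * max (a ^ 2) (b ^ 2) := by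
      rcases le_total a b with h | h
      · calc (a + b) ^ 2 ≤ (b + b) ^ 2 := by gcongr
          _ = 4 * b ^ 2 := by ring
          _ ≤ _ := by gcongr; exact le_max_right _ _
      · calc (a + b) ^ 2 ≤ (a + a) ^ 2 := by gcongr
          _ = 4 * a ^ 2 := by ring
          _ ≤ _ := by gcongr; exact le_max_left _ _
    calc g x * (a + b) ^ 2 ≤ g x * (4 * max (a ^ 2) (b ^ 2)) := by gcongr
      _ = g x * max (a ^ 2) (b ^ 2) * 4 := by ring
      _ ≤ ENNReal.ofReal (t ^ 2) * 4 := by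
        gcongr
        rcases max_choice (a ^ 2) (b ^ 2) with h | h <;> rw [h]
        exacts [hcon.1, hcon.2]
  have hTset : MeasurableSet {z : EuclideanSpace ℝ (Fin N) × ℝ |
      ENNReal.ofReal (z.2 ^ 2) < T z.1 / 4} :=
    measurableSet_lt (by fun_prop) (by fun_prop)
  have hlayer : ∫⁻ x, T x / 4 ≤ ∫⁻ t in Set.Ioi (0 : ℝ), ENNReal.ofReal (2 * t) *
      volume {x | ENNReal.ofReal (t ^ 2) < T x / 4} := by
    calc ∫⁻ x, T x / 4 ≤ ∫⁻ x, ∫⁻ t in Set.Ioi (0 : ℝ),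
          if ENNReal.ofReal (t ^ 2) < T x / 4 then ENNReal.ofReal (2 * t) else 0 :=
          lintegral_mono fun x => le_lintegral_two_mul _
      _ = ∫⁻ t in Set.Ioi (0 : ℝ), ∫⁻ x,
          if ENNReal.ofReal (t ^ 2) < T x / 4 then ENNReal.ofReal (2 * t) else 0 := by
          apply lintegral_lintegral_swap
          exact (Measurable.ite hTset (by fun_prop) measurable_const).aemeasurable
      _ = _ := by
          refine lintegral_congr fun t => ?_
          have hm : MeasurableSet {x | ENNReal.ofReal (t ^ 2) < T x / 4} :=
            measurableSet_lt (by fun_prop) (by fun_prop)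
          rw [← lintegral_indicator_const hm]
          exact lintegral_congr fun x => by simp [Set.indicator_apply]
  -- Tonelli's theorem moves the integral over levels inside, leaving for each `y` one of the two
  -- scalar integrals bounded above.
  have hterm : ∀ (p : ℝ) (C K : ℝ) (h : ℝ → EuclideanSpace ℝ (Fin N) → ℝ≥0∞), 0 ≤ p → 0 ≤ C → 0 ≤ K →
      Measurable (Function.uncurry h) →
      (∀ y, ∫⁻ t in Set.Ioi (0 : ℝ), ENNReal.ofReal (2 * t * t ^ (-p)) * h t y ^ p ≤
        ENNReal.ofReal K * f y ^ 2) →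
      ∫⁻ t in Set.Ioi (0 : ℝ), ENNReal.ofReal (2 * t) *
        (ENNReal.ofReal (C * t ^ (-p)) * ∫⁻ y, h t y ^ p) ≤
        ENNReal.ofReal (K * C) * ∫⁻ y, f y ^ 2 := by
    intro p C K h hp hC hK hh hle
    have hhm : ∀ t, Measurable (h t) := fun t => hh.comp measurable_prodMk_left
    calc _ = ∫⁻ t in Set.Ioi (0 : ℝ), ENNReal.ofReal C * ∫⁻ y,
          ENNReal.ofReal (2 * t * t ^ (-p)) * h t y ^ p := by
          refine setLIntegral_congr_fun measurableSet_Ioi fun t (ht : 0 < t) => ?_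
          rw [lintegral_const_mul _ ((hhm t).pow_const p), ← mul_assoc, ← mul_assoc,
            ← ENNReal.ofReal_mul (by positivity), ← ENNReal.ofReal_mul (by positivity)]
          congr 2
          ring
      _ = ENNReal.ofReal C * ∫⁻ y, ∫⁻ t in Set.Ioi (0 : ℝ),
          ENNReal.ofReal (2 * t * t ^ (-p)) * h t y ^ p := by
          rw [lintegral_const_mul' _ _ ENNReal.ofReal_ne_top, lintegral_lintegral_swap]
          have : Measurable fun z : ℝ × EuclideanSpace ℝ (Fin N) => h z.1 z.2 ^ p :=
            hh.pow_const p
          exact (Measurable.mul (by fun_prop) this).aemeasurable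
      _ ≤ ENNReal.ofReal C * ∫⁻ y, ENNReal.ofReal K * f y ^ 2 := by
          gcongr with y
          exact hle y
      _ = _ := by
          rw [lintegral_const_mul' _ _ ENNReal.ofReal_ne_top, ← mul_assoc,
            ← ENNReal.ofReal_mul hC, mul_comm C]
  have hmain : ∫⁻ x, T x / 4 ≤ ENNReal.ofReal (4 * C₀ + 8 * C₁) * ∫⁻ y, f y ^ 2 := by
    refine hlayer.trans ?_
    calc _ ≤ ∫⁻ t in Set.Ioi (0 : ℝ), (ENNReal.ofReal (2 * t) *
          (ENNReal.ofReal (C₀ * t ^ (-(3 / 2) : ℝ)) * ∫⁻ y, f₁ t y ^ (3 / 2 : ℝ)) +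
          ENNReal.ofReal (2 * t) *
          (ENNReal.ofReal (C₁ * t ^ (-(9 / 4) : ℝ)) * ∫⁻ y, f₂ t y ^ (9 / 4 : ℝ))) := by
          refine setLIntegral_mono' measurableSet_Ioi fun t ht => ?_
          rw [← mul_add]
          gcongr
          exact hdist t ht
      _ = _ + _ := by
          apply lintegral_add_left
          have : Measurable fun t => ∫⁻ y, f₁ t y ^ (3 / 2 : ℝ) :=
            Measurable.lintegral_prod_right' (hf₁p.pow_const _)
          fun_prop
      _ ≤ _ := by
          rw [ENNReal.ofReal_add (by positivity) (by positivity), add_mul]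
          refine add_le_add (hterm _ _ _ _ (by norm_num) hC₀.le (by norm_num) hf₁p fun y => ?_)
            (hterm _ _ _ _ (by norm_num) hC₁.le (by norm_num) hf₂p fun y => ?_)
          · simpa only [hf₁, ENNReal.ofReal_ofNat] using lintegral_two_mul_rpow_le_small (f y)
          · simpa only [hf₂, ENNReal.ofReal_ofNat] using lintegral_two_mul_rpow_le_large (f y)
  calc ∫⁻ x, T x = 4 * ∫⁻ x, T x / 4 := by
        rw [← lintegral_const_mul' _ _ (by norm_num)]
        refine lintegral_congr fun x => ?_
        rw [ENNReal.mul_div_cancel (by norm_num) (by norm_num)]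
    _ ≤ 4 * (ENNReal.ofReal (4 * C₀ + 8 * C₁) * ∫⁻ y, f y ^ 2) := by gcongr
    _ = _ := by
        rw [← mul_assoc, ENNReal.ofReal_mul (by norm_num)]
        simp

/-! ### Green's identity and the pointwise bound by a Newtonian potential. -/

lemma laplacian_eq_sum_fderiv {N : ℕ} {f : EuclideanSpace ℝ (Fin N) → ℝ} (hf : ContDiff ℝ 2 f)
    (y : EuclideanSpace ℝ (Fin N)) :
    Laplacian.laplacian f y = ∑ i : Fin N,
      fderiv ℝ (fun z => fderiv ℝ f z (EuclideanSpace.single i 1)) y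
        (EuclideanSpace.single i 1) := by
  rw [InnerProductSpace.laplacian_eq_iteratedFDeriv_orthonormalBasis f
    (EuclideanSpace.basisFun (Fin N) ℝ)]
  refine Finset.sum_congr rfl fun i _ => ?_
  have hd : DifferentiableAt ℝ (fderiv ℝ f) y :=
    (hf.fderiv_right (m := 1) (by norm_num)).differentiable (by norm_num) y
  rw [iteratedFDeriv_two_apply, fderiv_clm_apply hd (differentiableAt_const _)]
  simp

lemma continuous_laplacian {N : ℕ} {f : EuclideanSpace ℝ (Fin N) → ℝ} (hf : ContDiff ℝ 2 f) :
    Continuous (Laplacian.laplacian f) := by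
  rw [InnerProductSpace.laplacian_eq_iteratedFDeriv_orthonormalBasis f
    (EuclideanSpace.basisFun (Fin N) ℝ)]
  have := hf.continuous_iteratedFDeriv (m := 2) le_rfl
  fun_prop

lemma hasCompactSupport_laplacian {N : ℕ} {f : EuclideanSpace ℝ (Fin N) → ℝ}
    (hf : HasCompactSupport f) : HasCompactSupport (Laplacian.laplacian f) := by
  refine hf.mono' fun x hx => ?_
  by_contra hcon
  refine hx ?_
  have h0 : f =ᶠ[𝓝 x] fun _ => 0 := notMem_tsupport_iff_eventuallyEq.1 hcon
  rw [InnerProductSpace.laplacian_congr_nhds h0 |>.self_of_nhds]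
  simp

/-- Green's second identity, without boundary term. -/
lemma integral_mul_laplacian_comm {N : ℕ} {f φ : EuclideanSpace ℝ (Fin N) → ℝ}
    (hf : ContDiff ℝ 2 f) (hφ : ContDiff ℝ 2 φ) (hc : HasCompactSupport φ) :
    ∫ x, f x * Laplacian.laplacian φ x = ∫ x, Laplacian.laplacian f x * φ x := by
  have hd1 : ∀ {h : EuclideanSpace ℝ (Fin N) → ℝ}, ContDiff ℝ 2 h → ∀ v,
      ContDiff ℝ 1 (fun z => fderiv ℝ h z v) := fun hh v =>
    (hh.fderiv_right (m := 1) (by norm_num)).clm_apply contDiff_const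
  have hd2 : ∀ {h : EuclideanSpace ℝ (Fin N) → ℝ}, ContDiff ℝ 2 h → ∀ v,
      Continuous (fun z => fderiv ℝ (fun w => fderiv ℝ h w v) z v) := fun hh v =>
    ((hd1 hh v).continuous_fderiv (by norm_num)).clm_apply continuous_const
  have hcs : ∀ v, HasCompactSupport (fun z => fderiv ℝ φ z v) := fun v => hc.fderiv_apply ℝ v
  have hint : ∀ {h k : EuclideanSpace ℝ (Fin N) → ℝ}, Continuous h → Continuous k →
      HasCompactSupport k → Integrable (fun x => h x * k x) := fun hh hk hkc =>
    (hh.mul hk).integrable_of_hasCompactSupport hkc.mul_left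
  have hcs2 : ∀ v, HasCompactSupport (fun z => fderiv ℝ (fun w => fderiv ℝ φ w v) z v) :=
    fun v => (hcs v).fderiv_apply ℝ v
  simp_rw [laplacian_eq_sum_fderiv hf, laplacian_eq_sum_fderiv hφ, Finset.mul_sum, Finset.sum_mul]
  rw [integral_finsetSum _ fun i _ => hint hf.continuous (hd2 hφ _) (hcs2 _),
    integral_finsetSum _ fun i _ => hint (hd2 hf _) hφ.continuous hc]
  refine Finset.sum_congr rfl fun i _ => ?_
  set v : EuclideanSpace ℝ (Fin N) := EuclideanSpace.single i 1
  rw [integral_mul_fderiv_eq_neg_fderiv_mul_of_integrable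
      (hint (hd1 hf v).continuous (hd1 hφ v).continuous (hcs v))
      (hint hf.continuous (hd2 hφ v) (hcs2 v))
      (hint hf.continuous (hd1 hφ v).continuous (hcs v))
      (fun x _ => hf.differentiable (by norm_num) x)
      (fun x _ => (hd1 hφ v).differentiable (by norm_num) x),
    integral_mul_fderiv_eq_neg_fderiv_mul_of_integrable
      (hint (hd2 hf v) hφ.continuous hc)
      (hint (hd1 hf v).continuous (hd1 hφ v).continuous (hcs v))
      (hint (hd1 hf v).continuous hφ.continuous hc)
      (fun x _ => (hd1 hf v).differentiable (by norm_num) x)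
      (fun x _ => hφ.differentiable (by norm_num) x), neg_neg]

lemma contDiff_norm_sub_sq_add_rpow {N : ℕ} {n : WithTop ℕ∞} (x : EuclideanSpace ℝ (Fin N)) {δ : ℝ}
    (hδ : 0 < δ) (a : ℝ) : ContDiff ℝ n fun y => (‖y - x‖ ^ 2 + δ) ^ a :=
  (((contDiff_id.sub contDiff_const).norm_sq ℝ).add contDiff_const).rpow_const_of_ne
    fun y => by positivity

lemma fderiv_norm_sub_sq_add_rpow {N : ℕ} (x : EuclideanSpace ℝ (Fin N)) {δ : ℝ}
    (hδ : 0 < δ) (a : ℝ) (y : EuclideanSpace ℝ (Fin N)) (i : Fin N) :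
    fderiv ℝ (fun y => (‖y - x‖ ^ 2 + δ) ^ a) y (EuclideanSpace.single i 1) =
      2 * a * ((‖y - x‖ ^ 2 + δ) ^ (a - 1) * (y i - x i)) := by
  have h1 : HasFDerivAt (fun y => ‖y - x‖ ^ 2 + δ) _ y :=
    (((hasFDerivAt_id y).sub_const x).norm_sq).add_const δ
  have h2 := h1.rpow_const (p := a) (Or.inl (by positivity))
  rw [h2.fderiv]
  simp [EuclideanSpace.inner_single_right]
  ring

/-- The Laplacian of the regularised fundamental solution. -/
lemma laplacian_regularised_newton {N : ℕ} (x : EuclideanSpace ℝ (Fin N)) {δ : ℝ}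
    (hδ : 0 < δ) (y : EuclideanSpace ℝ (Fin N)) :
    Laplacian.laplacian (fun y => (‖y - x‖ ^ 2 + δ) ^ ((2 - N : ℝ) / 2)) y =
      -(N * (N - 2) * δ * (‖y - x‖ ^ 2 + δ) ^ (-((N + 2 : ℝ) / 2))) := by
  rw [laplacian_eq_sum_fderiv (contDiff_norm_sub_sq_add_rpow x hδ _)]
  set a := (2 - N : ℝ) / 2 with ha
  have hρ : 0 < ‖y - x‖ ^ 2 + δ := by positivity
  have key : ∀ i : Fin N, fderiv ℝ (fun z => fderiv ℝ (fun y => (‖y - x‖ ^ 2 + δ) ^ a) z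
      (EuclideanSpace.single i 1)) y (EuclideanSpace.single i 1) =
      2 * a * (2 * (a - 1) * (‖y - x‖ ^ 2 + δ) ^ (a - 2) * (y i - x i) ^ 2 +
        (‖y - x‖ ^ 2 + δ) ^ (a - 1)) := by
    intro i
    simp_rw [fderiv_norm_sub_sq_add_rpow x hδ a _ i]
    have hd : DifferentiableAt ℝ (fun z : EuclideanSpace ℝ (Fin N) =>
        (‖z - x‖ ^ 2 + δ) ^ (a - 1)) y :=
      (contDiff_norm_sub_sq_add_rpow (n := 1) x hδ _).differentiable (by norm_num) y
    have hc : HasFDerivAt (fun z : EuclideanSpace ℝ (Fin N) => z i - x i)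
        (EuclideanSpace.proj i : EuclideanSpace ℝ (Fin N) →L[ℝ] ℝ) y :=
      (EuclideanSpace.proj i : EuclideanSpace ℝ (Fin N) →L[ℝ] ℝ).hasFDerivAt.sub_const _
    have h := (hd.hasFDerivAt.mul hc).const_mul (2 * a)
    refine (congrArg (fun L => L (EuclideanSpace.single i 1)) h.fderiv).trans ?_
    have h3 := fderiv_norm_sub_sq_add_rpow x hδ (a - 1) y i
    have h4 : a - 1 - 1 = a - 2 := by ring
    rw [h4] at h3
    simp [h3]
    ring
  simp_rw [key]
  rw [← Finset.mul_sum, Finset.sum_add_distrib, ← Finset.mul_sum, Finset.sum_const]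
  have hn : ∑ i, (y i - x i) ^ 2 = ‖y - x‖ ^ 2 := by
    simp [EuclideanSpace.norm_sq_eq]
  -- With both powers brought to exponent `a - 2`, the terms in `‖y - x‖²` cancel because `2 (a - 1)
  -- = -N`; only the multiple of `δ` survives.
  have e1 : (‖y - x‖ ^ 2 + δ) ^ (a - 1) = (‖y - x‖ ^ 2 + δ) ^ (a - 2) * (‖y - x‖ ^ 2 + δ) := by
    nth_rw 3 [← Real.rpow_one (‖y - x‖ ^ 2 + δ)]
    rw [← Real.rpow_add hρ]
    congr 1; ring
  have e2 : -((N + 2 : ℝ) / 2) = a - 2 := by rw [ha]; ring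
  rw [hn, e1, e2]
  simp only [Finset.card_univ, Fintype.card_fin, nsmul_eq_mul]
  rw [ha]
  ring

/-- A compactly supported function is bounded by the Newtonian potential of its Laplacian. -/
lemma exists_abs_le_newtonPotential_laplacian {N : ℕ} (hN : 3 ≤ N) :
    ∃ c : ℝ, 0 < c ∧ ∀ φ : EuclideanSpace ℝ (Fin N) → ℝ, ContDiff ℝ 2 φ → HasCompactSupport φ →
      ∀ x, ‖φ x‖ₑ ≤ ENNReal.ofReal c * newtonPotential (fun y => ‖Laplacian.laplacian φ y‖ₑ) x := by
  have hN3 : (3 : ℝ) ≤ N := by exact_mod_cast hN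
  -- Up to the factor `-N(N-2)`, `w` is the profile of the Laplacian of the regularised kernel. Its
  -- rescalings form an approximate identity whose mass need only be finite and positive.
  set w : EuclideanSpace ℝ (Fin N) → ℝ := fun z => (1 + ‖z‖ ^ 2) ^ (-(N + 2 : ℝ) / 2) with hw
  have hwint : Integrable w :=
    integrable_rpow_neg_one_add_norm_sq (by simp)
  have hwpos : ∀ z, 0 < w z := fun z => by positivity
  set I := N * (N - 2) * ∫ z, w z with hI
  have hI0 : 0 < I := by
    have : 0 < ∫ z, w z := by
      refine (integral_pos_iff_support_of_nonneg (fun z => (hwpos z).le) hwint).2 ?_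
      have : Function.support w = Set.univ := Set.eq_univ_of_forall fun z => (hwpos z).ne'
      rw [this]
      exact Measure.measure_univ_pos.2 (NeZero.ne _)
    have : (0 : ℝ) < N - 2 := by linarith
    positivity
  refine ⟨I⁻¹, by positivity, fun φ hφ hc x => ?_⟩
  obtain ⟨M, hM⟩ := hc.exists_bound_of_continuous hφ.continuous
  set ε : ℕ → ℝ := fun n => 1 / ((n : ℝ) + 1) with hε
  have hε0 : ∀ n, 0 < ε n := fun n => by positivity
  set J : ℕ → ℝ := fun n => ∫ z, w z * φ (x + ε n • z) with hJ
  have hJlim : Tendsto J atTop (𝓝 (∫ z, w z * φ x)) := by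
    refine tendsto_integral_of_dominated_convergence (fun z => w z * M) (fun n => ?_)
      (hwint.mul_const M) (fun n => ae_of_all _ fun z => ?_) (ae_of_all _ fun z => ?_)
    · have := hφ.continuous
      exact hwint.aestronglyMeasurable.mul (by fun_prop : Continuous _).aestronglyMeasurable
    · rw [norm_mul, Real.norm_of_nonneg (hwpos z).le]
      exact mul_le_mul_of_nonneg_left (hM _) (hwpos z).le
    · refine Tendsto.const_mul _ ?_
      have h0 : Tendsto (fun n => x + ε n • z) atTop (𝓝 (x + (0 : ℝ) • z)) :=
        ((tendsto_one_div_add_atTop_nhds_zero_nat (𝕜 := ℝ)).smul_const z).const_add x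
      rw [zero_smul, add_zero] at h0
      exact (hφ.continuous.tendsto x).comp h0
  -- Green's identity with `δ = ε²`, followed by the substitution `y = x + ε z`, in which all powers
  -- of `ε` cancel.
  have hJeq : ∀ n, (N * (N - 2) : ℝ) * J n = -∫ y, (‖y - x‖ ^ 2 + ε n ^ 2) ^ ((2 - N : ℝ) / 2) *
      Laplacian.laplacian φ y := by
    intro n
    have he := hε0 n
    rw [integral_mul_laplacian_comm (contDiff_norm_sub_sq_add_rpow x (by positivity) _) hφ hc]
    simp_rw [laplacian_regularised_newton x (pow_pos he 2)]
    have h1 := integral_add_left_eq_self (μ := (volume : Measure (EuclideanSpace ℝ (Fin N))))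
      (fun y => -(N * (N - 2) * ε n ^ 2 * (‖y - x‖ ^ 2 + ε n ^ 2) ^ (-((N + 2 : ℝ) / 2))) * φ y) x
    have h2 := Measure.integral_comp_smul (volume : Measure (EuclideanSpace ℝ (Fin N)))
      (fun y => -(N * (N - 2) * ε n ^ 2 * (‖(x + y) - x‖ ^ 2 + ε n ^ 2) ^ (-((N + 2 : ℝ) / 2)))
        * φ (x + y)) (ε n)
    rw [h1] at h2
    rw [finrank_euclideanSpace_fin, abs_of_pos (by positivity), smul_eq_mul,
      eq_inv_mul_iff_mul_eq₀ (by positivity)] at h2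
    simp only [hJ]
    rw [← h2, ← integral_const_mul, ← integral_const_mul, ← integral_neg]
    refine integral_congr_ae (ae_of_all _ fun z => ?_)
    dsimp only
    have e1 : ‖x + ε n • z - x‖ ^ 2 + ε n ^ 2 = ε n ^ 2 * (1 + ‖z‖ ^ 2) := by
      rw [add_sub_cancel_left, norm_smul, Real.norm_of_nonneg he.le]
      ring
    rw [e1, Real.mul_rpow (by positivity) (by positivity), ← Real.rpow_natCast (ε n) 2,
      ← Real.rpow_mul he.le, hw]
    dsimp only
    have e2 : ((2 : ℕ) : ℝ) * -((N + 2 : ℝ) / 2) = -((N + 2 : ℕ) : ℝ) := by push_cast; ring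
    rw [e2, Real.rpow_neg he.le, Real.rpow_natCast, Real.rpow_natCast, pow_add]
    have e3 : -((N + 2 : ℝ) / 2) = -(N + 2 : ℝ) / 2 := by ring
    rw [e3]
    field_simp
  -- The bound is uniform in `n`: since `2 - N` is negative, regularising only decreases the kernel.
  have hbound : ∀ n, ‖(N * (N - 2) : ℝ) * J n‖ₑ ≤
      newtonPotential (fun y => ‖Laplacian.laplacian φ y‖ₑ) x := by
    intro n
    rw [hJeq n, enorm_neg]
    refine (enorm_integral_le_lintegral_enorm _).trans ?_
    refine lintegral_mono_ae ?_
    have hne : ∀ᵐ y : EuclideanSpace ℝ (Fin N), y ≠ x := by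
      have : NeZero N := ⟨by omega⟩
      exact Measure.ae_ne volume x
    filter_upwards [hne] with y hy
    have hyx : 0 < ‖y - x‖ := norm_pos_iff.2 (sub_ne_zero.2 hy)
    rw [enorm_mul]
    gcongr
    rw [newtonKernel, norm_sub_rev x y, Real.enorm_of_nonneg (by positivity)]
    gcongr
    calc (‖y - x‖ ^ 2 + ε n ^ 2) ^ ((2 - N : ℝ) / 2) ≤ (‖y - x‖ ^ 2) ^ ((2 - N : ℝ) / 2) :=
          Real.rpow_le_rpow_of_nonpos (by positivity) (by simp; positivity) (by linarith)
      _ = ‖y - x‖ ^ (2 - N : ℝ) := by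
          rw [← Real.rpow_natCast, ← Real.rpow_mul hyx.le]
          congr 1
          push_cast
          ring
  have hlim : Tendsto (fun n => ‖(N * (N - 2) : ℝ) * J n‖ₑ) atTop (𝓝 ‖I * φ x‖ₑ) := by
    have : I * φ x = (N * (N - 2) : ℝ) * ∫ z, w z * φ x := by
      rw [integral_mul_const, hI]
      ring
    rw [this]
    exact (hJlim.const_mul _).enorm
  have hle := le_of_tendsto' hlim hbound
  calc ‖φ x‖ₑ = ENNReal.ofReal I⁻¹ * ‖I * φ x‖ₑ := by
        rw [enorm_mul, ← mul_assoc, Real.enorm_of_nonneg hI0.le, ← ENNReal.ofReal_mul (by positivity),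
          inv_mul_cancel₀ hI0.ne']
        simp
    _ ≤ _ := by gcongr

/-! ### The inequality for test functions and its extension to the completion. -/

lemma ofReal_sq_eq_enorm_sq (a : ℝ) : ENNReal.ofReal (a ^ 2) = ‖a‖ₑ ^ 2 := by
  rw [← sq_abs, ENNReal.ofReal_pow (abs_nonneg a), ← Real.enorm_eq_ofReal_abs]

lemma lintegral_ofReal_sq_eq {α : Type*} [MeasurableSpace α] (μ : Measure α) (f : α → ℝ) :
    ∫⁻ x, ENNReal.ofReal (f x ^ 2) ∂μ = eLpNorm f 2 μ ^ 2 := by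
  have h := eLpNorm_nnreal_pow_eq_lintegral (f := f) (μ := μ) (p := 2) (by norm_num)
  simp only [NNReal.coe_ofNat, ENNReal.coe_ofNat, ENNReal.rpow_ofNat] at h
  rw [h]
  simp_rw [ofReal_sq_eq_enorm_sq]

/-- The Hardy–Rellich inequality for test functions, with weight in weak `L^{N/4}`. -/
lemma exists_lintegral_mul_sq_le_laplacian {N : ℕ} (hN : 5 ≤ N)
    {g : EuclideanSpace ℝ (Fin N) → ℝ≥0∞} (hg : Measurable g) {A : ℝ} (hA : 0 ≤ A)
    (hgA : ∀ s : ℝ, 0 < s →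
      volume {x | ENNReal.ofReal s < g x} ≤ ENNReal.ofReal (A * s ^ (-(N / 4) : ℝ))) :
    ∃ C : ℝ, 0 < C ∧ ∀ φ : EuclideanSpace ℝ (Fin N) → ℝ, ContDiff ℝ 2 φ → HasCompactSupport φ →
      ∫⁻ x, g x * ENNReal.ofReal (φ x ^ 2) ≤
        ENNReal.ofReal C * ∫⁻ x, ENNReal.ofReal (Laplacian.laplacian φ x ^ 2) := by
  obtain ⟨C, hC, hmain⟩ := exists_lintegral_mul_newtonPotential_sq_le hN hg hA hgA
  obtain ⟨c, hc, hrep⟩ := exists_abs_le_newtonPotential_laplacian (N := N) (by omega)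
  refine ⟨c ^ 2 * C, by positivity, fun φ hφ hcs => ?_⟩
  simp_rw [ofReal_sq_eq_enorm_sq]
  set V := newtonPotential (fun y => ‖Laplacian.laplacian φ y‖ₑ) with hV
  have hlm : Measurable fun y => ‖Laplacian.laplacian φ y‖ₑ :=
    (continuous_laplacian hφ).measurable.enorm
  calc ∫⁻ x, g x * ‖φ x‖ₑ ^ 2 ≤ ∫⁻ x, ENNReal.ofReal (c ^ 2) * (g x * V x ^ 2) := by
        refine lintegral_mono fun x => ?_
        calc g x * ‖φ x‖ₑ ^ 2 ≤ g x * (ENNReal.ofReal c * V x) ^ 2 := by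
              gcongr
              exact hrep φ hφ hcs x
          _ = _ := by
              rw [ENNReal.ofReal_pow hc.le]
              ring
    _ = ENNReal.ofReal (c ^ 2) * ∫⁻ x, g x * V x ^ 2 :=
        lintegral_const_mul' _ _ ENNReal.ofReal_ne_top
    _ ≤ ENNReal.ofReal (c ^ 2) * (ENNReal.ofReal C * ∫⁻ y, ‖Laplacian.laplacian φ y‖ₑ ^ 2) := by
        gcongr
        exact hmain _ hlm
    _ = _ := by rw [← mul_assoc, ← ENNReal.ofReal_mul (by positivity)]

/-- If `t` is below the measure of `{g > s}`, then `g^*(t) ≥ s`, so `t^(4/N) s` is at most the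
quasinorm; solve for `t` and let it increase to that measure. -/
lemma MemWeakLp.exists_distribution_le {N : ℕ} (hN : 1 ≤ N) {Ω : Set (EuclideanSpace ℝ (Fin N))}
    {g : EuclideanSpace ℝ (Fin N) → ℝ≥0∞} (h : MemWeakLp Ω ((N : ℝ) / 4) g) :
    ∃ A : ℝ, 0 ≤ A ∧ ∀ s : ℝ, 0 < s →
      distribution Ω g (ENNReal.ofReal s) ≤ ENNReal.ofReal (A * s ^ (-(N / 4) : ℝ)) := by
  obtain ⟨-, -, hL⟩ := h
  set L := lorentzQuasinorm Ω ((N : ℝ) / 4) g with hLdef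
  have hN0 : (0 : ℝ) < N / 4 := by
    have : (0 : ℝ) < N := by exact_mod_cast hN
    positivity
  refine ⟨L.toReal ^ (N / 4 : ℝ), by positivity, fun s hs => ?_⟩
  refine ENNReal.le_of_forall_nnreal_lt fun t ht => ?_
  rcases eq_or_ne t 0 with rfl | ht0
  · simp
  have ht0 : 0 < (t : ℝ) := by positivity
  have hstar : ENNReal.ofReal s ≤ rearrangement Ω g t := by
    refine le_sInf fun s' hs' => ?_
    by_contra! hlt
    have hmono : distribution Ω g (ENNReal.ofReal s) ≤ distribution Ω g s' :=
      measure_mono fun x hx => ⟨hx.1, hlt.trans hx.2⟩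
    have h2 := hs'.2
    rw [ENNReal.ofReal_coe_nnreal] at h2
    exact (ht.trans_le hmono).not_gt h2
  have hle : ENNReal.ofReal ((t : ℝ) ^ (1 / ((N : ℝ) / 4))) * ENNReal.ofReal s ≤ L :=
    le_trans (by gcongr) (le_iSup₂_of_le (f := fun (t : ℝ) (_ : 0 < t) =>
      ENNReal.ofReal (t ^ (1 / ((N : ℝ) / 4))) * rearrangement Ω g t) (t : ℝ) ht0 le_rfl)
  rw [← ENNReal.ofReal_mul (by positivity), ENNReal.ofReal_le_iff_le_toReal hL.ne] at hle
  rw [← ENNReal.ofReal_coe_nnreal]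
  refine ENNReal.ofReal_le_ofReal ?_
  calc (t : ℝ) = ((t : ℝ) ^ (1 / ((N : ℝ) / 4))) ^ ((N : ℝ) / 4) := by
        rw [← Real.rpow_mul ht0.le, one_div_mul_cancel hN0.ne', Real.rpow_one]
    _ ≤ (L.toReal / s) ^ ((N : ℝ) / 4) := by
        gcongr
        rwa [le_div_iff₀ hs]
    _ = _ := by
        rw [Real.div_rpow (by positivity) hs.le, Real.rpow_neg hs.le, div_eq_mul_inv]

lemma IsTestFunction.contDiff_two {N : ℕ} {Ω : Set (EuclideanSpace ℝ (Fin N))}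
    {φ : EuclideanSpace ℝ (Fin N) → ℝ} (h : IsTestFunction Ω φ) : ContDiff ℝ 2 φ :=
  contDiff_infty.1 h.1 2

lemma IsTestFunction.eq_zero_of_notMem {N : ℕ} {Ω : Set (EuclideanSpace ℝ (Fin N))}
    {φ : EuclideanSpace ℝ (Fin N) → ℝ} (h : IsTestFunction Ω φ) {x : EuclideanSpace ℝ (Fin N)}
    (hx : x ∉ Ω) : φ x = 0 :=
  image_eq_zero_of_notMem_tsupport fun hx' => hx (h.2.2 hx')

lemma IsTestFunction.laplacian_eq_zero_of_notMem {N : ℕ} {Ω : Set (EuclideanSpace ℝ (Fin N))}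
    {φ : EuclideanSpace ℝ (Fin N) → ℝ} (h : IsTestFunction Ω φ) {x : EuclideanSpace ℝ (Fin N)}
    (hx : x ∉ Ω) : Laplacian.laplacian φ x = 0 := by
  have h0 : φ =ᶠ[𝓝 x] fun _ => 0 :=
    notMem_tsupport_iff_eventuallyEq.1 fun hx' => hx (h.2.2 hx')
  rw [InnerProductSpace.laplacian_congr_nhds h0 |>.self_of_nhds]
  simp

lemma IsTestFunction.integrableOn_mul {N : ℕ} {Ω : Set (EuclideanSpace ℝ (Fin N))}
    {φ w : EuclideanSpace ℝ (Fin N) → ℝ} (h : IsTestFunction Ω φ) (hw : LocallyIntegrableOn w Ω) :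
    Integrable fun x => w x * φ x := by
  have h1 : IntegrableOn w (tsupport φ) := hw.integrableOn_compact_subset h.2.2 h.2.1
  have h2 : IntegrableOn (fun x => w x * φ x) (tsupport φ) :=
    h1.mul_continuousOn h.1.continuous.continuousOn h.2.1
  refine (integrableOn_iff_integrable_of_support_subset ?_).1 h2
  exact fun x hx => subset_tsupport φ (right_ne_zero_of_mul hx)

/-- The weak Laplacian is unique almost everywhere. -/
lemma IsWeakLaplacian.ae_eq {N : ℕ} {Ω : Set (EuclideanSpace ℝ (Fin N))} (hΩ : IsOpen Ω)
    {u w w' : EuclideanSpace ℝ (Fin N) → ℝ} (h : IsWeakLaplacian Ω u w)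
    (h' : IsWeakLaplacian Ω u w') : w =ᵐ[volume.restrict Ω] w' := by
  have key := hΩ.ae_eq_zero_of_integral_contDiff_smul_eq_zero (h.2.1.sub h'.2.1)
    (fun φ hφ hc hs => by
      have ht : IsTestFunction Ω φ := ⟨hφ, hc, hs⟩
      have e := (h.2.2 φ ht).symm.trans (h'.2.2 φ ht)
      rw [setIntegral_eq_integral_of_forall_compl_eq_zero
          (fun x hx => by rw [ht.eq_zero_of_notMem hx, mul_zero]),
        setIntegral_eq_integral_of_forall_compl_eq_zero
          (fun x hx => by rw [ht.eq_zero_of_notMem hx, mul_zero])] at e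
      have : ∀ x, φ x • (w - w') x = w x * φ x - w' x * φ x := fun x => by
        simp only [Pi.sub_apply, smul_eq_mul]
        ring
      simp_rw [this]
      rw [integral_sub (ht.integrableOn_mul h.2.1) (ht.integrableOn_mul h'.2.1), e, sub_self])
  refine (ae_restrict_iff' hΩ.measurableSet).2 ?_
  filter_upwards [key] with x hx hxΩ
  exact sub_eq_zero.1 (hx hxΩ)

lemma IsTestFunction.isWeakLaplacian {N : ℕ} {Ω : Set (EuclideanSpace ℝ (Fin N))}
    {u : EuclideanSpace ℝ (Fin N) → ℝ} (h : IsTestFunction Ω u) :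
    IsWeakLaplacian Ω u (Laplacian.laplacian u) := by
  refine ⟨(h.1.continuous.locallyIntegrable).locallyIntegrableOn _,
    ((continuous_laplacian h.contDiff_two).locallyIntegrable).locallyIntegrableOn _,
    fun φ hφ => ?_⟩
  rw [setIntegral_eq_integral_of_forall_compl_eq_zero
      (fun x hx => by rw [h.eq_zero_of_notMem hx, zero_mul]),
    setIntegral_eq_integral_of_forall_compl_eq_zero
      (fun x hx => by rw [hφ.eq_zero_of_notMem hx, mul_zero])]
  exact integral_mul_laplacian_comm h.contDiff_two hφ.contDiff_two hφ.2.1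

lemma IsTestFunction.memD22 {N : ℕ} {Ω : Set (EuclideanSpace ℝ (Fin N))}
    {u : EuclideanSpace ℝ (Fin N) → ℝ} (h : IsTestFunction Ω u) : MemD22 Ω u :=
  ⟨Laplacian.laplacian u, h.isWeakLaplacian,
    ((continuous_laplacian h.contDiff_two).memLp_of_hasCompactSupport
      (hasCompactSupport_laplacian h.2.1)).restrict Ω,
    fun _ => u, fun _ => h, by simp, by simp⟩

lemma lintegral_laplacian_sq_lt_top {N : ℕ} {φ : EuclideanSpace ℝ (Fin N) → ℝ}
    (hφ : ContDiff ℝ 2 φ) (hc : HasCompactSupport φ) :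
    ∫⁻ x, ENNReal.ofReal (Laplacian.laplacian φ x ^ 2) < ∞ := by
  rw [lintegral_ofReal_sq_eq]
  exact ENNReal.pow_lt_top ((continuous_laplacian hφ).memLp_of_hasCompactSupport
    (hasCompactSupport_laplacian hc)).2

lemma exists_isTestFunction_eq_one {N : ℕ} {Ω K : Set (EuclideanSpace ℝ (Fin N))} (hΩ : IsOpen Ω)
    (hK : IsCompact K) (hKΩ : K ⊆ Ω) :
    ∃ φ : EuclideanSpace ℝ (Fin N) → ℝ, IsTestFunction Ω φ ∧ ∀ x ∈ K, φ x = 1 := by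
  obtain ⟨L, hL, hKL, hLΩ⟩ := exists_compact_between hK hΩ hKΩ
  obtain ⟨f, hf1, hf0, -⟩ := exists_contMDiffMap_one_nhds_of_subset_interior (n := ⊤)
    (modelWithCornersSelf ℝ (EuclideanSpace ℝ (Fin N))) hK.isClosed hKL
  have hsupp : Function.support f ⊆ L := fun x hx => by
    by_contra hxL
    exact hx (hf0 x hxL)
  have hts : tsupport f ⊆ L := closure_minimal hsupp hL.isClosed
  exact ⟨f, ⟨f.contMDiff.contDiff, hL.of_isClosed_subset (isClosed_tsupport _) hts, hts.trans hLΩ⟩,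
    fun x hx => hf1.self_of_nhdsSet x hx⟩

/-- An inequality for test functions extends to the completion. -/
lemma admissible_of_forall_isTestFunction {N : ℕ} {Ω : Set (EuclideanSpace ℝ (Fin N))}
    (hΩ : IsOpen Ω) {g : EuclideanSpace ℝ (Fin N) → ℝ≥0∞}
    (hg : AEMeasurable g (volume.restrict Ω)) {C : ℝ} (hC : 0 < C)
    (h : ∀ φ, IsTestFunction Ω φ → ∫⁻ x in Ω, g x * ENNReal.ofReal (φ x ^ 2) ≤
      ENNReal.ofReal C * ∫⁻ x in Ω, ENNReal.ofReal (Laplacian.laplacian φ x ^ 2)) :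
    Admissible Ω g := by
  have hloc : ∀ K : Set (EuclideanSpace ℝ (Fin N)), IsCompact K → K ⊆ Ω →
      ∫⁻ x in K, g x < ∞ := by
    intro K hK hKΩ
    -- Local integrability follows from the inequality itself, tested on a cutoff equal to `1` on
    -- `K`.
    obtain ⟨φ, hφ, hφ1⟩ := exists_isTestFunction_eq_one hΩ hK hKΩ
    calc ∫⁻ x in K, g x = ∫⁻ x in K, g x * ENNReal.ofReal (φ x ^ 2) := by
          refine setLIntegral_congr_fun hK.measurableSet fun x hx => ?_
          simp [hφ1 x hx]
      _ ≤ ∫⁻ x in Ω, g x * ENNReal.ofReal (φ x ^ 2) := lintegral_mono_set hKΩ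
      _ ≤ ENNReal.ofReal C * ∫⁻ x, ENNReal.ofReal (Laplacian.laplacian φ x ^ 2) := by
          refine (h φ hφ).trans ?_
          gcongr
          exact Measure.restrict_le_self
      _ < ∞ := ENNReal.mul_lt_top ENNReal.ofReal_lt_top
          (lintegral_laplacian_sq_lt_top hφ.contDiff_two hφ.2.1)
  refine ⟨hloc, C, hC, fun u w hu huw => ?_⟩
  obtain ⟨w', huw', hw', φ, hφ, hφu, hφw⟩ := hu
  have hww : ∫⁻ x in Ω, ENNReal.ofReal (w x ^ 2) = eLpNorm w' 2 (volume.restrict Ω) ^ 2 := by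
    rw [lintegral_ofReal_sq_eq, eLpNorm_congr_ae (huw.ae_eq hΩ huw')]
  rw [hww]
  set W := eLpNorm w' 2 (volume.restrict Ω) with hW
  have hcompact : ∀ K : Set (EuclideanSpace ℝ (Fin N)), IsCompact K → K ⊆ Ω →
      ∫⁻ x in K, g x * ENNReal.ofReal (u x ^ 2) ≤ ENNReal.ofReal C * W ^ 2 := by
    intro K hK hKΩ
    have huK : AEStronglyMeasurable u (volume.restrict K) :=
      (huw.1.integrableOn_compact_subset hKΩ hK).aestronglyMeasurable
    have hgK : AEMeasurable g (volume.restrict K) := hg.mono_set hKΩ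
    -- Convergence in `L¹(K)` gives an a.e. convergent subsequence, as needed for Fatou's lemma.
    have hconv : TendstoInMeasure (volume.restrict K) φ atTop u := by
      refine tendstoInMeasure_of_tendsto_eLpNorm (p := 1) one_ne_zero
        (fun n => (hφ n).1.continuous.aestronglyMeasurable) huK ?_
      refine (hφu K hK hKΩ).congr fun n => ?_
      rw [eLpNorm_one_eq_lintegral_enorm]
      refine lintegral_congr fun x => ?_
      rw [Pi.sub_apply, enorm_sub_rev]
    obtain ⟨ns, hns, hae⟩ := hconv.exists_seq_tendsto_ae
    have hbound : ∀ n, ∫⁻ x in K, g x * ENNReal.ofReal (φ n x ^ 2) ≤ ENNReal.ofReal C *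
        (W + eLpNorm (fun x => w' x - Laplacian.laplacian (φ n) x) 2 (volume.restrict Ω)) ^ 2 := by
      intro n
      refine (lintegral_mono_set hKΩ).trans ((h _ (hφ n)).trans ?_)
      rw [lintegral_ofReal_sq_eq]
      gcongr
      have hcl : AEStronglyMeasurable (Laplacian.laplacian (φ n)) (volume.restrict Ω) :=
        (continuous_laplacian (hφ n).contDiff_two).aestronglyMeasurable
      have e : Laplacian.laplacian (φ n) = w' - (fun x => w' x - Laplacian.laplacian (φ n) x) := by
        ext x
        simp
      conv_lhs => rw [e]
      exact eLpNorm_sub_le hw'.1 (hw'.1.sub hcl) one_le_two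
    have hlim : Tendsto (fun i => ENNReal.ofReal C *
        (W + eLpNorm (fun x => w' x - Laplacian.laplacian (φ (ns i)) x) 2
          (volume.restrict Ω)) ^ 2) atTop (𝓝 (ENNReal.ofReal C * W ^ 2)) := by
      refine ENNReal.Tendsto.const_mul ?_ (Or.inr ENNReal.ofReal_ne_top)
      refine ENNReal.Tendsto.pow ?_
      simpa using (hφw.comp hns.tendsto_atTop).const_add W
    calc ∫⁻ x in K, g x * ENNReal.ofReal (u x ^ 2)
        ≤ ∫⁻ x in K, liminf (fun i => g x * ENNReal.ofReal (φ (ns i) x ^ 2)) atTop := by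
          refine lintegral_mono_ae ?_
          -- Finiteness of `g x` matters: multiplication by `∞` is not continuous at `0`.
          filter_upwards [hae, ae_lt_top' hgK (hloc K hK hKΩ).ne] with x hx hgx
          refine (Tendsto.liminf_eq ?_).ge
          exact ENNReal.Tendsto.const_mul (ENNReal.tendsto_ofReal (hx.pow 2)) (Or.inr hgx.ne)
      _ ≤ liminf (fun i => ∫⁻ x in K, g x * ENNReal.ofReal (φ (ns i) x ^ 2)) atTop := by
          refine lintegral_liminf_le' fun i => hgK.mul ?_
          have := (hφ (ns i)).1.continuous
          exact (by fun_prop : Measurable fun x => ENNReal.ofReal (φ (ns i) x ^ 2)).aemeasurable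
      _ ≤ liminf (fun i => ENNReal.ofReal C *
          (W + eLpNorm (fun x => w' x - Laplacian.laplacian (φ (ns i)) x) 2
            (volume.restrict Ω)) ^ 2) atTop :=
          liminf_le_liminf (Eventually.of_forall fun i => hbound (ns i))
      _ = _ := hlim.liminf_eq
  -- The bound on `K` does not depend on `K`, so an increasing compact exhaustion of `Ω` concludes.
  have : LocallyCompactSpace Ω := hΩ.locallyCompactSpace
  obtain ⟨K, hK, hKΩ⟩ : IsSigmaCompact Ω := isSigmaCompact_iff_sigmaCompactSpace.2 inferInstance
  have hacc : ⋃ n, Set.accumulate K n = Ω := by rw [Set.iUnion_accumulate, hKΩ]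
  rw [← hacc, setLIntegral_iUnion_of_directed _
    (directed_of_isDirected_le Set.monotone_accumulate)]
  exact iSup_le fun n => hcompact _ (isCompact_accumulate hK n)
    (hacc ▸ Set.subset_iUnion (Set.accumulate K) n)

lemma admissible_of_memWeakLp {N : ℕ} (hN : 5 ≤ N) {Ω : Set (EuclideanSpace ℝ (Fin N))}
    (hΩ : IsOpen Ω) {g : EuclideanSpace ℝ (Fin N) → ℝ≥0∞} (h : MemWeakLp Ω ((N : ℝ) / 4) g) :
    Admissible Ω g := by
  have hg := h.1
  obtain ⟨A, hA, hgA⟩ := h.exists_distribution_le (by omega)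
  -- A Borel representative extended by zero, so that the estimates on the whole space apply.
  set g₀ := Ω.indicator (hg.mk g) with hg₀
  have hg₀m : Measurable g₀ := hg.measurable_mk.indicator hΩ.measurableSet
  have hdist : ∀ s : ℝ, 0 < s →
      volume {x | ENNReal.ofReal s < g₀ x} ≤ ENNReal.ofReal (A * s ^ (-(N / 4) : ℝ)) := by
    intro s hs
    refine le_trans (measure_mono_ae ?_) (hgA s hs)
    filter_upwards [(ae_restrict_iff' hΩ.measurableSet).1 hg.ae_eq_mk] with x hx hxs
    have hxs : ENNReal.ofReal s < g₀ x := hxs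
    by_cases hxΩ : x ∈ Ω
    · refine ⟨hxΩ, ?_⟩
      rw [hx hxΩ]
      rwa [hg₀, Set.indicator_of_mem hxΩ] at hxs
    · rw [hg₀, Set.indicator_of_notMem hxΩ] at hxs
      exact absurd hxs not_lt_zero
  obtain ⟨C, hC, hmain⟩ := exists_lintegral_mul_sq_le_laplacian hN hg₀m hA hdist
  refine admissible_of_forall_isTestFunction hΩ hg hC fun φ hφ => ?_
  calc ∫⁻ x in Ω, g x * ENNReal.ofReal (φ x ^ 2)
      = ∫⁻ x in Ω, g₀ x * ENNReal.ofReal (φ x ^ 2) := by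
        refine lintegral_congr_ae ?_
        filter_upwards [hg.ae_eq_mk, ae_restrict_mem hΩ.measurableSet] with x hx hxΩ
        rw [hg₀, Set.indicator_of_mem hxΩ, hx]
    _ ≤ ∫⁻ x, g₀ x * ENNReal.ofReal (φ x ^ 2) := setLIntegral_le_lintegral _ _
    _ ≤ _ := hmain φ hφ.contDiff_two hφ.2.1
    _ = _ := by
        congr 1
        rw [← lintegral_indicator hΩ.measurableSet]
        refine lintegral_congr fun x => ?_
        by_cases hxΩ : x ∈ Ω
        · rw [Set.indicator_of_mem hxΩ]
        · rw [Set.indicator_of_notMem hxΩ, hφ.laplacian_eq_zero_of_notMem hxΩ]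
          simp

/-! ### The converse for radially decreasing weights. -/

lemma laplacian_comp_smul {N : ℕ} {f : EuclideanSpace ℝ (Fin N) → ℝ} (hf : ContDiff ℝ 2 f) (a : ℝ)
    (x : EuclideanSpace ℝ (Fin N)) :
    Laplacian.laplacian (fun y => f (a • y)) x = a ^ 2 * Laplacian.laplacian f (a • x) := by
  simp only [InnerProductSpace.laplacian_eq_iteratedFDeriv_orthonormalBasis _
    (EuclideanSpace.basisFun (Fin N) ℝ)]
  rw [iteratedFDeriv_comp_const_smul (i := 2) a hf]
  simp [Finset.mul_sum]

/-- Scaling of the energy `∫ |Δφ|²`. -/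
lemma lintegral_laplacian_comp_inv_smul_sq {N : ℕ} {φ : EuclideanSpace ℝ (Fin N) → ℝ}
    (hφ : ContDiff ℝ 2 φ) {r : ℝ} (hr : 0 < r) :
    ∫⁻ y, ENNReal.ofReal (Laplacian.laplacian (fun y => φ (r⁻¹ • y)) y ^ 2) =
      ENNReal.ofReal (r ^ N * (r ^ 4)⁻¹) * ∫⁻ y, ENNReal.ofReal (Laplacian.laplacian φ y ^ 2) := by
  have hm := (continuous_laplacian hφ).measurable
  simp_rw [laplacian_comp_smul hφ]
  rw [← lintegral_comp_smul_pos hr (by fun_prop), ENNReal.ofReal_mul (by positivity), mul_assoc]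
  congr 1
  rw [← lintegral_const_mul' _ _ ENNReal.ofReal_ne_top]
  refine lintegral_congr fun y => ?_
  rw [← ENNReal.ofReal_mul (by positivity), smul_smul, inv_mul_cancel₀ hr.ne', one_smul]
  congr 1
  field_simp

/-- An admissible radially decreasing weight is at most of order `‖x‖ ^ (-4)`. -/
lemma Admissible.exists_le_norm_rpow {N : ℕ} (hN : 1 ≤ N) {Ω : Set (EuclideanSpace ℝ (Fin N))}
    {g : EuclideanSpace ℝ (Fin N) → ℝ≥0∞} (hΩ : ∀ x ∈ Ω, ∀ y, ‖y‖ ≤ ‖x‖ → y ∈ Ω)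
    (hdec : IsRadiallyDecreasingOn Ω g) (h : Admissible Ω g) :
    ∃ B : ℝ, 0 < B ∧ ∀ x ∈ Ω, x ≠ 0 → g x ≤ ENNReal.ofReal (B / ‖x‖ ^ 4) := by
  obtain ⟨-, C, hC, hadm⟩ := h
  let b : ContDiffBump (0 : EuclideanSpace ℝ (Fin N)) := ⟨1, 3 / 2, by norm_num, by norm_num⟩
  have hb2 : ContDiff ℝ 2 b := b.contDiff
  set M := (∫⁻ y, ENNReal.ofReal (Laplacian.laplacian (⇑b) y ^ 2)).toReal with hM
  have hMeq : ∫⁻ y, ENNReal.ofReal (Laplacian.laplacian (⇑b) y ^ 2) = ENNReal.ofReal M :=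
    (ENNReal.ofReal_toReal (lintegral_laplacian_sq_lt_top hb2 b.hasCompactSupport).ne).symm
  have hM0 : 0 ≤ M := ENNReal.toReal_nonneg
  set v := (volume (Metric.ball (0 : EuclideanSpace ℝ (Fin N)) 1)).toReal with hv
  have hvpos : 0 < v := ENNReal.toReal_pos
    (Metric.measure_ball_pos _ _ one_pos).ne' measure_ball_lt_top.ne
  have hNE : Nontrivial (EuclideanSpace ℝ (Fin N)) := by
    have : NeZero N := ⟨by omega⟩
    infer_instance
  -- The factor `16` is `(‖x‖ / r)^4` for `r = ‖x‖ / 2`; the summand `1` keeps the constant positive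
  -- without showing `M > 0`.
  refine ⟨16 * (C * M / v) + 1, by positivity, fun x hx hx0 => ?_⟩
  have hxn : 0 < ‖x‖ := norm_pos_iff.2 hx0
  -- The rescaled bump is `1` on radius `r` and vanishes beyond `3r/2 < ‖x‖`, so its support stays
  -- inside `Ω`, and `g ≥ g x` on the smaller ball.
  set r := ‖x‖ / 2 with hr
  have hr0 : 0 < r := by positivity
  set φ : EuclideanSpace ℝ (Fin N) → ℝ := fun y => b (r⁻¹ • y) with hφdef
  have hsupp : tsupport φ ⊆ Metric.closedBall 0 (3 / 2 * r) := by
    refine closure_minimal (fun y hy => ?_) Metric.isClosed_closedBall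
    have hy' : r⁻¹ • y ∈ Function.support b := hy
    rw [b.support_eq, mem_ball_zero_iff, norm_smul, norm_inv, Real.norm_of_nonneg hr0.le,
      inv_mul_lt_iff₀ hr0] at hy'
    have hy' : ‖y‖ < r * (3 / 2) := hy'
    rw [mem_closedBall_zero_iff]
    linarith
  have hφ : IsTestFunction Ω φ := by
    refine ⟨b.contDiff.comp (contDiff_const_smul r⁻¹), ?_, fun y hy => hΩ x hx y ?_⟩
    · exact (isCompact_closedBall _ _).of_isClosed_subset (isClosed_tsupport _) hsupp
    · have := mem_closedBall_zero_iff.1 (hsupp hy)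
      linarith
  have key := hadm φ _ hφ.memD22 hφ.isWeakLaplacian
  have hball : ∀ y ∈ Metric.ball (0 : EuclideanSpace ℝ (Fin N)) r, y ∈ Ω ∧ g x ≤ g y ∧ φ y = 1 := by
    intro y hy
    have hy : ‖y‖ < r := mem_ball_zero_iff.1 hy
    have hyx : ‖y‖ < ‖x‖ := by linarith
    have hyΩ := hΩ x hx y hyx.le
    refine ⟨hyΩ, hdec y hyΩ x hx hyx, b.one_of_mem_closedBall ?_⟩
    rw [mem_closedBall_zero_iff, norm_smul, norm_inv, Real.norm_of_nonneg hr0.le,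
      inv_mul_le_iff₀ hr0]
    change ‖y‖ ≤ r * 1
    linarith
  have hvol : volume (Metric.ball (0 : EuclideanSpace ℝ (Fin N)) r) = ENNReal.ofReal (r ^ N * v) := by
    rw [Measure.addHaar_ball _ _ hr0.le, finrank_euclideanSpace_fin,
      ENNReal.ofReal_mul (by positivity), hv, ENNReal.ofReal_toReal measure_ball_lt_top.ne]
  have hchain : g x * ENNReal.ofReal (r ^ N * v) ≤
      ENNReal.ofReal (C * M / (r ^ 4) * r ^ N) := by
    calc g x * ENNReal.ofReal (r ^ N * v)
        = ∫⁻ y in Metric.ball (0 : EuclideanSpace ℝ (Fin N)) r, g x := by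
          rw [setLIntegral_const, hvol]
      _ ≤ ∫⁻ y in Metric.ball (0 : EuclideanSpace ℝ (Fin N)) r,
            g y * ENNReal.ofReal (φ y ^ 2) := by
          refine setLIntegral_mono' Metric.isOpen_ball.measurableSet fun y hy => ?_
          obtain ⟨-, h1, h2⟩ := hball y hy
          simpa [h2] using h1
      _ ≤ ∫⁻ y in Ω, g y * ENNReal.ofReal (φ y ^ 2) :=
          lintegral_mono_set fun y hy => (hball y hy).1
      _ ≤ ENNReal.ofReal C * ∫⁻ y, ENNReal.ofReal (Laplacian.laplacian φ y ^ 2) := by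
          refine key.trans ?_
          gcongr
          exact Measure.restrict_le_self
      _ = _ := by
          rw [hφdef, lintegral_laplacian_comp_inv_smul_sq hb2 hr0, hMeq,
            ← ENNReal.ofReal_mul (by positivity), ← ENNReal.ofReal_mul hC.le]
          congr 1
          ring
  have hpos : ENNReal.ofReal (r ^ N * v) ≠ 0 := by
    simp only [ne_eq, ENNReal.ofReal_eq_zero, not_le]
    positivity
  rw [← ENNReal.le_div_iff_mul_le (Or.inl hpos) (Or.inl ENNReal.ofReal_ne_top),
    ← ENNReal.ofReal_div_of_pos (by positivity)] at hchain
  refine hchain.trans (ENNReal.ofReal_le_ofReal ?_)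
  have e : C * M / r ^ 4 * r ^ N / (r ^ N * v) = 16 * (C * M / v) / ‖x‖ ^ 4 := by
    have : ‖x‖ = 2 * r := by rw [hr]; ring
    rw [this]
    field_simp
    norm_num
  rw [e]
  gcongr
  linarith

/-- The set `{g > s}` lies in the closed ball of radius `(B/s)^(1/4)`, whose volume is of order
`s^(-N/4)`. The origin, where `g` may be infinite, is a null set. -/
lemma memWeakLp_of_le_norm_rpow {N : ℕ} (hN : 1 ≤ N) {Ω : Set (EuclideanSpace ℝ (Fin N))}
    {g : EuclideanSpace ℝ (Fin N) → ℝ≥0∞} (hg : AEMeasurable g (volume.restrict Ω)) {B : ℝ}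
    (hB : 0 < B) (hgB : ∀ x ∈ Ω, x ≠ 0 → g x ≤ ENNReal.ofReal (B / ‖x‖ ^ 4))
    (hΩ : MeasurableSet Ω) : MemWeakLp Ω ((N : ℝ) / 4) g := by
  have hNE : Nontrivial (EuclideanSpace ℝ (Fin N)) := by
    have : NeZero N := ⟨by omega⟩
    infer_instance
  have hN0 : (0 : ℝ) < N := by exact_mod_cast hN
  refine ⟨hg, ?_, ?_⟩
  · rw [ae_restrict_iff' hΩ]
    filter_upwards [Measure.ae_ne volume (0 : EuclideanSpace ℝ (Fin N))] with x hx hxΩ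
    exact (hgB x hxΩ hx).trans_lt ENNReal.ofReal_lt_top
  set v := (volume (Metric.ball (0 : EuclideanSpace ℝ (Fin N)) 1)).toReal with hv
  have hvpos : 0 < v := ENNReal.toReal_pos
    (Metric.measure_ball_pos _ _ one_pos).ne' measure_ball_lt_top.ne
  have hdist : ∀ s : ℝ, 0 < s →
      distribution Ω g (ENNReal.ofReal s) ≤ ENNReal.ofReal ((B / s) ^ (N / 4 : ℝ) * v) := by
    intro s hs
    have hsub : {x ∈ Ω | ENNReal.ofReal s < g x} ⊆
        Metric.closedBall 0 ((B / s) ^ (1 / 4 : ℝ)) := by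
      rintro x ⟨hxΩ, hxs⟩
      rw [mem_closedBall_zero_iff]
      rcases eq_or_ne x 0 with rfl | hx0
      · rw [norm_zero]
        positivity
      have hxn : 0 < ‖x‖ := norm_pos_iff.2 hx0
      have h1 := hxs.trans_le (hgB x hxΩ hx0)
      rw [ENNReal.ofReal_lt_ofReal_iff (by positivity), lt_div_comm₀ hs (by positivity)] at h1
      calc ‖x‖ = (‖x‖ ^ 4) ^ (1 / 4 : ℝ) := by
            rw [← Real.rpow_natCast, ← Real.rpow_mul hxn.le]
            norm_num
        _ ≤ _ := by gcongr
    refine (measure_mono hsub).trans (le_of_eq ?_)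
    rw [Measure.addHaar_closedBall _ _ (by positivity), finrank_euclideanSpace_fin,
      ENNReal.ofReal_mul (by positivity), hv, ENNReal.ofReal_toReal measure_ball_lt_top.ne,
      ← Real.rpow_natCast, ← Real.rpow_mul (by positivity)]
    congr 3
    ring
  refine lt_of_le_of_lt (b := ENNReal.ofReal (B * (2 * v) ^ (4 / N : ℝ))) ?_ ENNReal.ofReal_lt_top
  refine iSup₂_le fun t ht => ?_
  -- The rearrangement asks for measure strictly less than `t`; this level makes the volume bound
  -- exactly `t / 2`, whence the factor `2 v`.
  have hle : rearrangement Ω g t ≤ ENNReal.ofReal (B * (2 * v / t) ^ (4 / N : ℝ)) := by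
    refine sInf_le ⟨ENNReal.ofReal_pos.2 (by positivity), ?_⟩
    refine (hdist _ (by positivity)).trans_lt ?_
    rw [ENNReal.ofReal_lt_ofReal_iff ht]
    have e : (B / (B * (2 * v / t) ^ (4 / N : ℝ))) ^ (N / 4 : ℝ) * v = t / 2 := by
      have e1 : B / (B * (2 * v / t) ^ (4 / N : ℝ)) = ((2 * v / t) ^ (4 / N : ℝ))⁻¹ := by
        field_simp
      have e2 : (4 / N : ℝ) * (N / 4) = 1 := by field_simp
      rw [e1, Real.inv_rpow (by positivity), ← Real.rpow_mul (by positivity), e2, Real.rpow_one]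
      field_simp
    rw [e]
    linarith
  calc ENNReal.ofReal (t ^ (1 / ((N : ℝ) / 4))) * rearrangement Ω g t
      ≤ ENNReal.ofReal (t ^ (1 / ((N : ℝ) / 4))) *
        ENNReal.ofReal (B * (2 * v / t) ^ (4 / N : ℝ)) := by gcongr
    _ = _ := by
        rw [← ENNReal.ofReal_mul (by positivity), Real.div_rpow (by positivity) ht.le, one_div_div]
        congr 1
        field_simp

end HardyRellich

theorem theorem1p1 (N : ℕ) (hN : 5 ≤ N) (Ω : Set (EuclideanSpace ℝ (Fin N))) (hΩ : IsOpen Ω)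
    (g : EuclideanSpace ℝ (Fin N) → ℝ≥0∞) (hg : AEMeasurable g (volume.restrict Ω)) :
    (HardyRellich.MemWeakLp Ω ((N : ℝ) / 4) g → HardyRellich.Admissible Ω g) ∧
    (((∃ R : ℝ, 0 < R ∧ Ω = Metric.ball 0 R) ∨ Ω = Set.univ) →
      HardyRellich.IsRadialOn Ω g → HardyRellich.IsRadiallyDecreasingOn Ω g →
      HardyRellich.Admissible Ω g → HardyRellich.MemWeakLp Ω ((N : ℝ) / 4) g) := by
  refine ⟨HardyRellich.admissible_of_memWeakLp hN hΩ, fun hball _ hdec hadm => ?_⟩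
  have hsub : ∀ x ∈ Ω, ∀ y, ‖y‖ ≤ ‖x‖ → y ∈ Ω := by
    rcases hball with ⟨R, -, rfl⟩ | rfl
    · intro x hx y hyx
      rw [mem_ball_zero_iff] at hx ⊢
      exact hyx.trans_lt hx
    · exact fun _ _ y _ => Set.mem_univ y
  obtain ⟨B, hB, hgB⟩ := hadm.exists_le_norm_rpow (by omega) hsub hdec
  exact HardyRellich.memWeakLp_of_le_norm_rpow (by omega) hg hB hgB hΩ.measurableSet
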